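/- **Model.** Let $\mathcal D$ be the càdlàg functions on $[0,1)$ and $\mathcal S$ the right-continuous step functions $g=\sum_{i=0}^k c_i 1_{[\tau_i,\tau_{i+1})}$ with $0=\tau_0<\dots<\tau_{k+1}=1$, $c_i\ne c_{i+1}$; write $J(g)=\{\tau_1,\dots,\tau_k\}$. For $f\in\mathcal D$ bounded one observes $$y_i^n(f)=n\int_{[i/n,(i+1)/n)}f(x)\,dx+\xi_i^n,\qquad i=0,\dots,n-1,$$ where for each $n$ the $\xi^n_0,\dots,\xi^n_{n-1}$ are independent with $E\,e^{u\xi_i^n}\le e^{u^2\sigma^2/2}$ for all $u\in\mathbb R$. For $\gamma,L>0$ let $$\mathcal A^\gamma_{2,L}=\Big\{f\in\mathcal D:\ \sup_{k\ge1}k^\gamma\inf\{\|f-g\|_{L^2}:g\in\mathcal S,\ \#J(g)\le k\}\le L,\ \|f\|_{L^\infty}\le L\Big\}.$$ **Estimator.** Fix $c>1$, $\delta>0$. For each $n\ge2$ let $\mathcal I=\mathcal I_n$ be a $c$-normal system of intervals $[a,b)\subseteq[0,1)$: their end-points lie in $\{i/n:0\le i\le n\}$, all $[i/n,(i+1)/n)$,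 $0\le i<n$, belong to $\mathcal I$, and every interval $I\subseteq[0,1)$ with $|I|>c/n$ contains some $\tilde I\in\mathcal I$ with $|\tilde I|\ge|I|/c$. Let $s_I$ be scale penalties, possibly random and possibly depending on the data and on the candidate $g$, such that almost surely $|s_I|\le\delta\sqrt{\log n}$ for all $n\ge 2$, $I\in\mathcal I$, all data and all candidates. Put $$T_{\mathcal I}(y;g)=\sup_{I\in\mathcal I,\ g\equiv c_I\text{ on }I}\Big\{\frac1{\sqrt{n|I|}}\Big|\sum_{i/n\in I}(y_i-c_I)\Big|-s_I\Big\}.$$ The multiscale change-point segmentation estimator $\hat f_n$ is any solution of the problem of minimizing $\#J(g)$ over the $g\in\mathcal S$ with $J(g)\subseteq\{i/n\}$ and $T_{\mathcal I}(y^n;g)\le\eta_n$. The threshold is one of the following. (a) $\eta_n=a\sqrt{\log n}$ with $a>\delta+\sigma\sqrt{2r+4}$ for some $r>0$. (b) The penalties are deterministic and do not depend on data or candidate, and $\eta_n$ is the $(1-\beta_n)$-quantile of $T_{\mathcal I}(\xi^n;0)$, where $\beta_n\in(0,1)$, $\beta_n=O(n^{-r})$ for some $r>0$ and $n^{-q}=O(\beta_n)$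 for some $q>0$; moreover, either the $\xi_i^n$ are Gaussian with variances bounded away from $0$, or there is $\varepsilon>0$ with $P\big(T_{\mathcal I}(\xi^n;0)\le\eta_n-\varepsilon\sqrt{\log n}\big)\to1$. **Proposition.** For $f\in\mathcal A^\gamma_{2,L}$ and $k\in\mathbb N_0$ let $f^{\rm app}_k$ be any best approximant of $f$ in $L^2[0,1)$ among the $g\in\mathcal S$ with $\#J(g)\le k$. For each $f$ let $\hat f_n$ be computed from $y^n(f)$, and let $\hat K_n=\#J(\hat f_n)$. Then there is a constant $C>0$ such that $$\lim_{n\to\infty}P\Big\{\sup_{f\in\mathcal A^\gamma_{2,L}}\|f-f^{\rm app}_{\hat K_n}\|_{L^2}\ \ge\ C\sup_{f\in\mathcal A^\gamma_{2,L}}\|f-\hat f_n\|_{L^2}\Big\}=1 .$$ (Here the event contains measurable events whose probabilities tend to $1$.) -/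

import Mathlib

open Set Filter Topology MeasureTheory ProbabilityTheory
open scoped NNReal ENNReal

namespace ChangePoint

/-! Signals on `[0,1)` are represented by functions `ℝ → ℝ`; every notion below only looks at
their values on `[0,1)`. -/

/-- Càdlàg on `[0,1)`: right-continuous at every point of `[0,1)`, with left limits on `(0,1)`. -/
def IsCadlag (f : ℝ → ℝ) : Prop :=
  (∀ x ∈ Ico (0 : ℝ) 1, ContinuousWithinAt f (Ici x) x) ∧
    ∀ x ∈ Ioo (0 : ℝ) 1, ∃ l : ℝ, Tendsto f (𝓝[<] x) (𝓝 l)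

/-- Right-continuous step functions `∑ i, c i * 1_[τ i, τ (i+1))` on `[0,1)` with
`0 = τ 0 < ⋯ < τ (k+1) = 1` and `c i ≠ c (i+1)`. -/
def IsStep (g : ℝ → ℝ) : Prop :=
  ∃ (k : ℕ) (τ : Fin (k + 2) → ℝ) (c : Fin (k + 1) → ℝ),
    StrictMono τ ∧ τ 0 = 0 ∧ τ (Fin.last (k + 1)) = 1 ∧
      (∀ i : Fin k, c i.castSucc ≠ c i.succ) ∧
      ∀ i : Fin (k + 1), ∀ x ∈ Ico (τ i.castSucc) (τ i.succ), g x = c i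

/-- The set of change-points: the discontinuities in `(0,1)`. -/
def jumpSet (g : ℝ → ℝ) : Set ℝ := {x ∈ Ioo (0 : ℝ) 1 | ¬ ContinuousAt g x}

/-- The number of jumps (only used for step functions, which have finitely many). -/
noncomputable def numJumps (g : ℝ → ℝ) : ℕ := (jumpSet g).ncard

/-- The `L^q` distance on `[0,1)`. -/
noncomputable def lqDist (q : ℝ≥0∞) (f g : ℝ → ℝ) : ℝ≥0∞ :=
  eLpNorm (fun x => f x - g x) q (volume.restrict (Ico (0 : ℝ) 1))

/-- The error `Δ_{q,k}(f)` of approximation by step functions with at most `k` jumps. -/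
noncomputable def approxErr (q : ℝ≥0∞) (k : ℕ) (f : ℝ → ℝ) : ℝ≥0∞ :=
  ⨅ g ∈ {g : ℝ → ℝ | IsStep g ∧ numJumps g ≤ k}, lqDist q f g

/-- The approximation class `𝒜^γ_{q,L}`. -/
def approxClass (q : ℝ≥0∞) (γ L : ℝ) : Set (ℝ → ℝ) :=
  {f | IsCadlag f ∧
    (⨆ k : ℕ, ⨆ _ : 1 ≤ k, ENNReal.ofReal ((k : ℝ) ^ γ) * approxErr q k f) ≤ ENNReal.ofReal L ∧
    eLpNorm f ∞ (volume.restrict (Ico (0 : ℝ) 1)) ≤ ENNReal.ofReal L}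

/-- `g` is a best `L²` approximant of `f` among the step functions with at most `k` jumps. -/
def IsBestApprox (f : ℝ → ℝ) (k : ℕ) (g : ℝ → ℝ) : Prop :=
  IsStep g ∧ numJumps g ≤ k ∧
    ∀ h : ℝ → ℝ, IsStep h → numJumps h ≤ k → lqDist 2 f g ≤ lqDist 2 f h

/-- The observations `y_i = n ∫_{[i/n,(i+1)/n)} f + ξ_i`, `i = 0, …, n-1`. -/
noncomputable def obs (n : ℕ) (f : ℝ → ℝ) (ξ : Fin n → ℝ) (i : Fin n) : ℝ :=
  (n : ℝ) * (∫ x in Ico ((i : ℝ) / n) (((i : ℝ) + 1) / n), f x) + ξ i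

/-- A `c`-normal system of intervals; the pair `I` stands for the interval `[I.1, I.2)`. -/
structure IsNormalSystem (c : ℝ) (n : ℕ) (𝓘 : Set (ℝ × ℝ)) : Prop where
  isInterval : ∀ I ∈ 𝓘, 0 ≤ I.1 ∧ I.1 < I.2 ∧ I.2 ≤ 1
  rich : ∀ a b : ℝ, 0 ≤ a → a < b → b ≤ 1 → c / n < b - a →
    ∃ I ∈ 𝓘, a ≤ I.1 ∧ I.2 ≤ b ∧ c⁻¹ * (b - a) ≤ I.2 - I.1
  grid : ∀ I ∈ 𝓘, ∃ i j : ℕ, i ≤ n ∧ j ≤ n ∧ I.1 = (i : ℝ) / n ∧ I.2 = (j : ℝ) / n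
  cells : ∀ i : ℕ, i < n → ((i : ℝ) / n, ((i : ℝ) + 1) / n) ∈ 𝓘

/-- The multiscale statistic `T_𝓘(y; g)` with scale penalties `s`: the supremum, over the
intervals `I` of the system on which `g` is equal to a constant `c`, of
`|∑_{i/n ∈ I} (y_i - c)| / √(n |I|) - s_I` (`-∞` if there is no such interval). -/
noncomputable def multiscaleStat (n : ℕ) (𝓘 : Set (ℝ × ℝ)) (s : ℝ × ℝ → ℝ) (y : Fin n → ℝ)
    (g : ℝ → ℝ) : EReal :=
  ⨆ I ∈ 𝓘, ⨆ c : ℝ, ⨆ _ : ∀ x ∈ Ico I.1 I.2, g x = c,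
    ((|∑ i : Fin n, (Ico I.1 I.2).indicator (fun _ => y i - c) ((i : ℝ) / n)|
        / √((n : ℝ) * (I.2 - I.1)) - s I : ℝ) : EReal)

/-- Step functions whose change-points lie on the sampling grid `{i/n}`. -/
def IsGridStep (n : ℕ) (g : ℝ → ℝ) : Prop :=
  IsStep g ∧ ∀ x ∈ jumpSet g, ∃ i : ℕ, x = (i : ℝ) / n

/-- `g` minimises the number of jumps subject to `T_𝓘(y; g) ≤ η`. The penalties `s h I` may
depend on the candidate `h`. -/
def IsSegmentation (n : ℕ) (𝓘 : Set (ℝ × ℝ)) (s : (ℝ → ℝ) → ℝ × ℝ → ℝ) (η : ℝ)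
    (y : Fin n → ℝ) (g : ℝ → ℝ) : Prop :=
  IsGridStep n g ∧ multiscaleStat n 𝓘 (s g) y g ≤ (η : EReal) ∧
    ∀ h : ℝ → ℝ, IsGridStep n h → multiscaleStat n 𝓘 (s h) y h ≤ (η : EReal) →
      numJumps g ≤ numJumps h

/-- A sequence of multiscale change-point segmentation estimators with constants `c`, `δ`,
interval systems `𝓘 n`, penalties `s n ω y h I` (random, and possibly depending on the data `y`
and the candidate `h`) and thresholds `η n`. The estimator `fhat n ω y` may be any solution of
the optimisation problem for the data `y`. -/
structure IsMultiscaleEstimator {Ω : Type*} [MeasurableSpace Ω] (μ : Measure Ω) (c δ : ℝ)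
    (𝓘 : ℕ → Set (ℝ × ℝ)) (s : (n : ℕ) → Ω → (Fin n → ℝ) → (ℝ → ℝ) → ℝ × ℝ → ℝ)
    (η : ℕ → ℝ) (fhat : (n : ℕ) → Ω → (Fin n → ℝ) → ℝ → ℝ) : Prop where
  one_lt : 1 < c
  normal : ∀ n, 2 ≤ n → IsNormalSystem c n (𝓘 n)
  pos : 0 < δ
  penalty : ∀ᵐ ω ∂μ, ∀ n, 2 ≤ n → ∀ (y : Fin n → ℝ) (h : ℝ → ℝ), IsGridStep n h →
    ∀ I ∈ 𝓘 n, |s n ω y h I| ≤ δ * √(Real.log n)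
  solution : ∀ᵐ ω ∂μ, ∀ n, 2 ≤ n → ∀ y : Fin n → ℝ,
    IsSegmentation n (𝓘 n) (s n ω y) (η n) y (fhat n ω y)

/-- The noise: a triangular array with independent rows of (centered) sub-Gaussian random
variables with scale parameter `σ`, that is, `E exp (u ξ) ≤ exp (u² σ² / 2)` for all `u`. -/
structure IsSubGaussianNoise {Ω : Type*} [MeasurableSpace Ω] (μ : Measure Ω) (σ : ℝ≥0)
    (ξ : (n : ℕ) → Fin n → Ω → ℝ) : Prop where
  measurable : ∀ n i, Measurable (ξ n i)
  indep : ∀ n, iIndepFun (ξ n) μ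
  subGaussian : ∀ n i, HasSubgaussianMGF (ξ n i) (σ ^ 2) μ

/-- The universal threshold `η = a √(log n)` with `a > δ + σ √(2r + 4)` for some `r > 0`. -/
def IsUniversalThreshold (σ δ : ℝ) (η : ℕ → ℝ) : Prop :=
  ∃ r : ℝ, 0 < r ∧ ∃ a : ℝ, δ + σ * √(2 * r + 4) < a ∧
    ∀ n, 2 ≤ n → η n = a * √(Real.log n)

/-- The statistic `T_𝓘(ξ; 0)` of pure noise. -/
noncomputable def noiseStat {Ω : Type*} (𝓘 : ℕ → Set (ℝ × ℝ)) (s₀ : ℕ → ℝ × ℝ → ℝ)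
    (ξ : (n : ℕ) → Fin n → Ω → ℝ) (n : ℕ) (ω : Ω) : EReal :=
  multiscaleStat n (𝓘 n) (s₀ n) (fun i => ξ n i ω) (fun _ => 0)

/-- The `(1-β)`-quantile `η(β)` of the distribution of `X`. -/
noncomputable def upperQuantile {Ω : Type*} [MeasurableSpace Ω] (μ : Measure Ω) (X : Ω → EReal)
    (β : ℝ) : ℝ :=
  sInf {x : ℝ | 1 - β ≤ μ.real {ω | X ω ≤ (x : EReal)}}

/-- The refined threshold `η = η(β_n)`, the `(1-β_n)`-quantile of `T_𝓘(ξ; 0)`, with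
`β_n = O(n^{-r})` and `n^{-q} = O(β_n)`, for deterministic penalties `s₀`. -/
def IsRefinedThreshold {Ω : Type*} [MeasurableSpace Ω] (μ : Measure Ω)
    (𝓘 : ℕ → Set (ℝ × ℝ)) (s : (n : ℕ) → Ω → (Fin n → ℝ) → (ℝ → ℝ) → ℝ × ℝ → ℝ)
    (s₀ : ℕ → ℝ × ℝ → ℝ) (ξ : (n : ℕ) → Fin n → Ω → ℝ) (η : ℕ → ℝ) : Prop :=
  (∀ n ω y h I, s n ω y h I = s₀ n I) ∧
    ∃ β : ℕ → ℝ, (∀ n, 2 ≤ n → 0 < β n ∧ β n < 1) ∧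
      (∃ r : ℝ, 0 < r ∧ β =O[atTop] fun n : ℕ => (n : ℝ) ^ (-r)) ∧
      (∃ q : ℝ, 0 < q ∧ (fun n : ℕ => (n : ℝ) ^ (-q)) =O[atTop] β) ∧
      ∀ n, 2 ≤ n → η n = upperQuantile μ (noiseStat 𝓘 s₀ ξ n) (β n)

/-- Gaussian noise with variances bounded away from zero. -/
def IsGaussianNoise {Ω : Type*} [MeasurableSpace Ω] (μ : Measure Ω)
    (ξ : (n : ℕ) → Fin n → Ω → ℝ) : Prop :=
  ∃ v₀ : ℝ≥0, 0 < v₀ ∧ ∀ n i, ∃ v : ℝ≥0, v₀ ≤ v ∧ μ.map (ξ n i) = gaussianReal 0 v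

/-- The threshold exceeds the statistic of pure noise by a margin of order `√(log n)`, with
probability tending to one. -/
def HasMargin {Ω : Type*} [MeasurableSpace Ω] (μ : Measure Ω)
    (𝓘 : ℕ → Set (ℝ × ℝ)) (s₀ : ℕ → ℝ × ℝ → ℝ) (ξ : (n : ℕ) → Fin n → Ω → ℝ)
    (η : ℕ → ℝ) : Prop :=
  ∃ ε : ℝ, 0 < ε ∧
    Tendsto (fun n => μ {ω | noiseStat 𝓘 s₀ ξ n ω ≤ ((η n - ε * √(Real.log n) : ℝ) : EReal)})
      atTop (𝓝 1)

end ChangePoint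

/-! Both suprema are compared with `k^(-γ)`, where `k` is of order `(n / log n)^(1/(2γ+1))` and
balances the squared approximation error `k^(-2γ)` against the stochastic error `k log n / n`.

Upper bound. Everything random is confined to one event, `IsGoodNoise`, which does not involve `f`:
on every interval of the system the normalised noise stays below penalty plus threshold, with a
margin `ε √(log n)` to spare. For each `f` in the class, `exists_oracle` modifies a step function
that approximates `f` well into a grid step function with `O(k)` jumps whose bias on every grid
interval of constancy fits into that margin. The oracle is therefore feasible
(`IsGoodNoise.feasible`), and since the estimator minimises the number of jumps, it has at most `C₁
k` of them, uniformly over the class. Two feasible candidates fit the same data on each interval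
where both are constant, and normality of the system supplies a tested interval of comparable length
inside it. Summing over `O(k)` such intervals gives a squared distance `O(k log n / n)`
(`lqDist_feasible_le`), hence an error `O(k^(-γ))` (`exists_upper_constants`).

Lower bound. A function of the class alternating between `±L (4K)^(-γ)` on `4K` cells, with `K = C₁
k`, cannot be approximated by `K` jumps to better than a multiple of `K^(-γ)`
(`lqDist_alternating_ge`). Its own estimate has at most `K` jumps, so its best approximant with that
many jumps is still this far away. This gives `exists_comparison_constant`.

Probability. For the universal threshold the good event follows from sub-Gaussian tails and a union
bound. For the quantile threshold, the size of the quantile follows from the same tails. In the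
Gaussian case the margin comes from rotation invariance (`gaussian_margin`): if falling just short
of the quantile were likely, then mixing in an independent copy of the noise would exceed the
quantile too often. -/

namespace ChangePoint

/-! ### Step functions on the sampling grid and their jumps -/

/-- The function on `[0,1)` equal to `w i` on the cell `[i/n, (i+1)/n)`. -/
noncomputable def gridFun (n : ℕ) (w : ℕ → ℝ) : ℝ → ℝ := fun x => w ⌊(n : ℝ) * x⌋₊

lemma gridFun_of_mem {n : ℕ} (hn : 0 < n) (w : ℕ → ℝ) {i : ℕ} {x : ℝ}
    (hx : x ∈ Ico ((i : ℝ) / n) (((i : ℝ) + 1) / n)) : gridFun n w x = w i := by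
  have hn' : (0 : ℝ) < n := by exact_mod_cast hn
  have h1 := (div_le_iff₀ hn').1 hx.1
  have h2 := (lt_div_iff₀ hn').1 hx.2
  have : ⌊(n : ℝ) * x⌋₊ = i := by
    rw [Nat.floor_eq_iff (by nlinarith [Nat.cast_nonneg (α := ℝ) i])]
    constructor <;> nlinarith
  simp [gridFun, this]

lemma exists_cell {n : ℕ} (hn : 0 < n) {x : ℝ} (hx : x ∈ Ico (0 : ℝ) 1) :
    ∃ i < n, x ∈ Ico ((i : ℝ) / n) (((i : ℝ) + 1) / n) := by
  have hn' : (0 : ℝ) < n := by exact_mod_cast hn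
  have h0 : 0 ≤ (n : ℝ) * x := mul_nonneg hn'.le hx.1
  refine ⟨⌊(n : ℝ) * x⌋₊, ?_, ?_, ?_⟩
  · rw [Nat.floor_lt h0]
    nlinarith [hx.2]
  · rw [div_le_iff₀ hn']
    linarith [Nat.floor_le h0]
  · rw [lt_div_iff₀ hn']
    linarith [Nat.lt_floor_add_one ((n : ℝ) * x)]

lemma eq_of_forall_succ_eq {α : Type*} (w : ℕ → α) {a b : ℕ}
    (h : ∀ i, a < i → i < b → w i = w (i - 1)) :
    ∀ i, a ≤ i → i < b → w i = w a := by
  intro i hai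
  induction i, hai using Nat.le_induction with
  | base => intro _; rfl
  | succ j hj ih =>
    intro hb
    rw [h (j + 1) (by omega) hb, Nat.add_sub_cancel, ih (by omega)]

lemma isStep_gridFun {n : ℕ} (hn : 0 < n) (w : ℕ → ℝ) : IsStep (gridFun n w) := by
  classical
  have hn' : (0 : ℝ) < n := by exact_mod_cast hn
  -- Neighbouring cells with equal values have to be merged, since consecutive values in `IsStep`
  -- differ: only genuine changes become breakpoints.
  set S : Finset ℕ := insert 0 (insert n ((Finset.Ico 1 n).filter fun i => w i ≠ w (i - 1)))
    with hS
  have h0S : 0 ∈ S := by simp [hS]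
  have hnS : n ∈ S := by simp [hS]
  have hSn : ∀ i ∈ S, i ≤ n := by
    intro i hi
    simp only [hS, Finset.mem_insert, Finset.mem_filter, Finset.mem_Ico] at hi
    omega
  have hcard : 2 ≤ S.card := by
    have : ({0, n} : Finset ℕ) ⊆ S := by
      intro i hi
      simp only [Finset.mem_insert, Finset.mem_singleton] at hi
      rcases hi with rfl | rfl <;> assumption
    calc 2 = ({0, n} : Finset ℕ).card := (Finset.card_pair (by omega)).symm
      _ ≤ _ := Finset.card_le_card this
  obtain ⟨k, hk⟩ : ∃ k, S.card = k + 2 := ⟨S.card - 2, by omega⟩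
  set e := S.orderEmbOfFin hk with he
  have heS : ∀ i, e i ∈ S := fun i => S.orderEmbOfFin_mem hk i
  have hesurj : ∀ j ∈ S, ∃ i, e i = j := by
    intro j hj
    have := S.range_orderEmbOfFin hk
    have hj' : j ∈ Set.range (S.orderEmbOfFin hk) := by rw [this]; exact hj
    exact hj'
  have he0 : e 0 = 0 := by
    obtain ⟨i, hi⟩ := hesurj 0 h0S
    have : e 0 ≤ e i := e.monotone (Fin.zero_le i)
    omega
  have hel : e (Fin.last (k + 1)) = n := by
    obtain ⟨i, hi⟩ := hesurj n hnS
    have : e i ≤ e (Fin.last _) := e.monotone (Fin.le_last i)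
    have := hSn _ (heS (Fin.last (k + 1)))
    omega
  have hbetween : ∀ i : Fin (k + 1), ∀ j, e i.castSucc ≤ j → j < e i.succ →
      w j = w (e i.castSucc) := by
    intro i
    apply eq_of_forall_succ_eq
    intro j h1 h2
    by_contra hne
    have hjS : j ∈ S := by
      simp only [hS, Finset.mem_insert, Finset.mem_filter, Finset.mem_Ico]
      have := hSn _ (heS i.succ)
      right; right
      exact ⟨by omega, hne⟩
    obtain ⟨l, rfl⟩ := hesurj j hjS
    have h1' := e.lt_iff_lt.1 h1
    have h2' := e.lt_iff_lt.1 h2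
    rw [Fin.lt_def] at h1' h2'
    simp at h1' h2'
    omega
  refine ⟨k, fun i => (e i : ℝ) / n, fun i => w (e i.castSucc), ?_, by simp [he0],
    by simp [hel, hn'.ne'], ?_, ?_⟩
  · intro i j hij
    have : e i < e j := e.strictMono hij
    have : (e i : ℝ) < e j := by exact_mod_cast this
    exact div_lt_div_of_pos_right this hn'
  · intro i
    have hlt : e i.castSucc.castSucc < e i.castSucc.succ :=
      e.strictMono (by simp [Fin.lt_def])
    have hlt2 : e i.castSucc.succ < e (Fin.last _) :=
      e.strictMono (by simp [Fin.lt_def])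
    have hmem := heS i.castSucc.succ
    simp only [hS, Finset.mem_insert, Finset.mem_filter, Finset.mem_Ico] at hmem
    have h3 := hbetween i.castSucc (e i.castSucc.succ - 1) (by omega) (by omega)
    have h4 : w (e i.castSucc.succ) ≠ w (e i.castSucc.succ - 1) := by
      rcases hmem with h | h | h
      · omega
      · omega
      · exact h.2
    rw [h3] at h4
    exact fun h => h4 h.symm
  · intro i x hx
    have h0x : 0 ≤ x := le_trans (by positivity) hx.1
    have h1 := (div_le_iff₀ hn').1 hx.1
    have h2 := (lt_div_iff₀ hn').1 hx.2
    apply hbetween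
    · exact Nat.le_floor (by linarith)
    · rw [Nat.floor_lt (by positivity)]
      linarith

lemma jumpSet_gridFun_subset {n : ℕ} (hn : 0 < n) (w : ℕ → ℝ) :
    jumpSet (gridFun n w) ⊆
      (fun i : ℕ => (i : ℝ) / n) '' ((Finset.Ico 1 n).filter fun i => w i ≠ w (i - 1)) := by
  have hn' : (0 : ℝ) < n := by exact_mod_cast hn
  rintro x ⟨hx, hxc⟩
  obtain ⟨i, hi, hxi⟩ := exists_cell hn ⟨hx.1.le, hx.2⟩
  rcases hxi.1.eq_or_lt with heq | hlt
  · refine ⟨i, ?_, heq⟩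
    have hi0 : 0 < i := by
      rcases Nat.eq_zero_or_pos i with rfl | h
      · simp at heq
        exact absurd heq hx.1.ne
      · exact h
    simp only [Finset.coe_filter, Finset.mem_Ico, Set.mem_ofPred_eq]
    refine ⟨⟨hi0, hi⟩, fun hw => hxc ?_⟩
    have hev : ∀ᶠ y in 𝓝 x, gridFun n w y = w i := by
      have hlo : ((i : ℝ) - 1) / n < x := by
        rw [← heq]; exact div_lt_div_of_pos_right (by linarith) hn'
      filter_upwards [Ioo_mem_nhds hlo hxi.2] with y hy
      rcases lt_or_ge y x with h | h
      · rw [hw]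
        apply gridFun_of_mem hn
        have : ((i - 1 : ℕ) : ℝ) = (i : ℝ) - 1 := by
          rw [Nat.cast_sub hi0]; simp
        rw [this]
        refine ⟨hy.1.le, ?_⟩
        rw [sub_add_cancel, heq]; exact h
      · exact gridFun_of_mem hn w ⟨hxi.1.trans h, hy.2⟩
    exact (continuousAt_const.congr (hev.mono fun y hy => hy.symm))
  · exfalso
    apply hxc
    have hev : ∀ᶠ y in 𝓝 x, gridFun n w y = w i := by
      filter_upwards [Ioo_mem_nhds hlt hxi.2] with y hy
      exact gridFun_of_mem hn w ⟨hy.1.le, hy.2⟩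
    exact (continuousAt_const.congr (hev.mono fun y hy => hy.symm))

lemma isGridStep_gridFun {n : ℕ} (hn : 0 < n) (w : ℕ → ℝ) : IsGridStep n (gridFun n w) := by
  refine ⟨isStep_gridFun hn w, fun x hx => ?_⟩
  obtain ⟨i, -, rfl⟩ := jumpSet_gridFun_subset hn w hx
  exact ⟨i, rfl⟩

lemma numJumps_gridFun_le {n : ℕ} (hn : 0 < n) (w : ℕ → ℝ) :
    numJumps (gridFun n w) ≤ ((Finset.Ico 1 n).filter fun i => w i ≠ w (i - 1)).card := by
  refine (Set.ncard_le_ncard (jumpSet_gridFun_subset hn w)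
    ((Finset.finite_toSet _).image _)).trans ?_
  refine (Set.ncard_image_le (Finset.finite_toSet _)).trans ?_
  rw [Set.ncard_coe_finset]

lemma exists_mem_Ico_of_strictMono {k : ℕ} {τ : Fin (k + 2) → ℝ} (h0 : τ 0 = 0)
    (h1 : τ (Fin.last (k + 1)) = 1) {x : ℝ} (hx : x ∈ Ico (0 : ℝ) 1) :
    ∃ i : Fin (k + 1), x ∈ Ico (τ i.castSucc) (τ i.succ) := by
  classical
  have hne : (Finset.univ.filter fun i : Fin (k + 1) => τ i.castSucc ≤ x).Nonempty :=
    ⟨0, by simp [h0, hx.1]⟩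
  set i := Finset.max' _ hne with hi
  have hmem := Finset.max'_mem _ hne
  rw [← hi] at hmem
  simp only [Finset.mem_filter, Finset.mem_univ, true_and] at hmem
  refine ⟨i, hmem, ?_⟩
  by_contra hcon
  push Not at hcon
  by_cases hl : i = Fin.last k
  · rw [hl, Fin.succ_last, h1] at hcon
    linarith [hx.2]
  · obtain ⟨j, hj⟩ := Fin.exists_castSucc_eq.2 hl
    have hmem2 : j.succ ∈ (Finset.univ.filter fun i : Fin (k + 1) => τ i.castSucc ≤ x) := by
      simp only [Finset.mem_filter, Finset.mem_univ, true_and]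
      rw [← hj] at hcon
      exact hcon
    have := Finset.le_max' _ _ hmem2
    rw [← hi, ← hj, Fin.le_def] at this
    simp at this

lemma IsStep.finite_jumpSet {g : ℝ → ℝ} (hg : IsStep g) : (jumpSet g).Finite := by
  obtain ⟨k, τ, c, hτ, h0, h1, hc, hgc⟩ := hg
  refine (Set.finite_range τ).subset ?_
  rintro x ⟨hx, hxc⟩
  obtain ⟨i, hi⟩ := exists_mem_Ico_of_strictMono h0 h1 ⟨hx.1.le, hx.2⟩
  rcases hi.1.eq_or_lt with heq | hlt
  · exact ⟨_, heq⟩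
  · exfalso
    apply hxc
    have hev : ∀ᶠ y in 𝓝 x, g y = c i := by
      filter_upwards [Ioo_mem_nhds hlt hi.2] with y hy
      exact hgc i y ⟨hy.1.le, hy.2⟩
    exact (continuousAt_const.congr (hev.mono fun y hy => hy.symm))

lemma mem_jumpSet_of_left_const {g : ℝ → ℝ} {a x v : ℝ} (hx : x ∈ Ioo (0 : ℝ) 1) (ha : a < x)
    (hg : ∀ y ∈ Ico a x, g y = v) (hne : g x ≠ v) : x ∈ jumpSet g := by
  refine ⟨hx, fun hcont => hne ?_⟩
  have h1 : Tendsto g (𝓝[<] x) (𝓝 (g x)) := hcont.tendsto.mono_left nhdsWithin_le_nhds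
  have h2 : Tendsto g (𝓝[<] x) (𝓝 v) := by
    refine tendsto_const_nhds.congr' ?_
    filter_upwards [Ico_mem_nhdsLT ha] with y hy
    exact (hg y hy).symm
  exact tendsto_nhds_unique h1 h2

/-- If the piece containing `a` ended before `b`, its right end would be a jump, because consecutive
values differ. -/
lemma IsStep.eq_of_no_jump {g : ℝ → ℝ} (hg : IsStep g) {a b : ℝ} (ha : 0 ≤ a) (hb : b ≤ 1)
    (hj : ∀ x ∈ Ioo a b, x ∉ jumpSet g) : ∀ x ∈ Ico a b, g x = g a := by
  intro x hx
  have hab : a < b := hx.1.trans_lt hx.2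
  obtain ⟨k, τ, c, hτ, h0, h1, hc, hgc⟩ := hg
  obtain ⟨i, hi⟩ := exists_mem_Ico_of_strictMono h0 h1 ⟨ha, hab.trans_le hb⟩
  have hbi : b ≤ τ i.succ := by
    by_contra hcon
    push Not at hcon
    refine hj _ ⟨hi.2, hcon⟩ ?_
    have hlt : τ i.castSucc < τ i.succ := hτ (by simp [Fin.lt_def])
    by_cases hl : i = Fin.last k
    · rw [hl, Fin.succ_last, h1] at hcon
      linarith
    · obtain ⟨j, hj'⟩ := Fin.exists_castSucc_eq.2 hl
      refine mem_jumpSet_of_left_const ⟨by linarith [hi.2], by linarith⟩ hlt (hgc i) ?_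
      have hs : g (τ j.succ.castSucc) = c j.succ := by
        apply hgc
        exact ⟨le_rfl, hτ (by simp [Fin.lt_def])⟩
      have he : τ i.succ = τ j.succ.castSucc := by rw [← hj']; rfl
      rw [he, hs, ← hj']
      exact (hc j).symm
  rw [hgc i a hi, hgc i x ⟨hi.1.trans hx.1, hx.2.trans_le hbi⟩]

lemma IsStep.isCadlag {g : ℝ → ℝ} (hg : IsStep g) : IsCadlag g := by
  have hfin := hg.finite_jumpSet
  constructor
  · intro x hx
    have h1 : ∀ᶠ b in 𝓝[>] x, ∀ y ∈ jumpSet g, ¬ y ∈ Ioo x b := by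
      rw [Filter.eventually_all_finite hfin]
      intro y hy
      rcases lt_or_ge x y with h | h
      · filter_upwards [Ioo_mem_nhdsGT h] with b hb hyb
        exact lt_asymm hb.2 hyb.2
      · exact Eventually.of_forall fun b hb => not_lt.2 h hb.1
    obtain ⟨b, hb, hb1⟩ := (h1.and (Ioo_mem_nhdsGT hx.2)).exists
    have hc := hg.eq_of_no_jump hx.1 hb1.2.le (fun y hy hyj => hb y hyj hy)
    refine (continuousWithinAt_const (b := g x)).congr_of_eventuallyEq ?_ rfl
    filter_upwards [Ico_mem_nhdsGE hb1.1] with y hy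
    exact hc y hy
  · intro x hx
    have h1 : ∀ᶠ a in 𝓝[<] x, ∀ y ∈ jumpSet g, ¬ y ∈ Ioo a x := by
      rw [Filter.eventually_all_finite hfin]
      intro y hy
      rcases lt_or_ge y x with h | h
      · filter_upwards [Ioo_mem_nhdsLT h] with a ha hya
        exact lt_asymm ha.1 hya.1
      · exact Eventually.of_forall fun b hb => not_lt.2 h hb.2
    obtain ⟨a, ha, ha1⟩ := (h1.and (Ioo_mem_nhdsLT hx.1)).exists
    have hc := hg.eq_of_no_jump ha1.1.le hx.2.le (fun y hy hyj => ha y hyj hy)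
    refine ⟨g a, tendsto_const_nhds.congr' ?_⟩
    filter_upwards [Ico_mem_nhdsLT ha1.2] with y hy
    exact (hc y hy).symm

/-- Right-continuity suffices: `f` is the pointwise limit of its values at grid points to the right
of `x`, and each of these approximations depends on `x` only through an integer. -/
lemma IsCadlag.aestronglyMeasurable {f : ℝ → ℝ} (hf : IsCadlag f) :
    AEStronglyMeasurable f (volume.restrict (Ico (0 : ℝ) 1)) := by
  have hm : ∀ m : ℕ, AEStronglyMeasurable
      (fun x : ℝ => f ((⌊((m : ℝ) + 1) * x⌋ + 1 : ℝ) / (m + 1)))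
      (volume.restrict (Ico (0 : ℝ) 1)) := by
    intro m
    have h1 : Measurable (fun z : ℤ => f ((z + 1 : ℝ) / (m + 1))) := measurable_of_countable _
    have h2 : Measurable (fun x : ℝ => ⌊((m : ℝ) + 1) * x⌋) :=
      Int.measurable_floor.comp (measurable_const.mul measurable_id)
    exact (h1.comp h2).aestronglyMeasurable
  refine aestronglyMeasurable_of_tendsto_ae atTop hm ?_
  filter_upwards [ae_restrict_mem measurableSet_Ico] with x hx
  have hc := hf.1 x hx
  refine hc.tendsto.comp (tendsto_nhdsWithin_iff.2 ⟨?_, ?_⟩)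
  · have hlim : Tendsto (fun m : ℕ => x + 1 / ((m : ℝ) + 1)) atTop (𝓝 x) := by
      simpa using tendsto_one_div_add_atTop_nhds_zero_nat.const_add x
    refine tendsto_of_tendsto_of_tendsto_of_le_of_le tendsto_const_nhds hlim ?_ ?_
    · intro m
      have hm : (0 : ℝ) < m + 1 := by positivity
      show x ≤ (⌊((m : ℝ) + 1) * x⌋ + 1 : ℝ) / (m + 1)
      rw [le_div_iff₀ hm]
      nlinarith [Int.lt_floor_add_one (((m : ℝ) + 1) * x)]
    · intro m
      have hm : (0 : ℝ) < m + 1 := by positivity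
      show (⌊((m : ℝ) + 1) * x⌋ + 1 : ℝ) / (m + 1) ≤ x + 1 / ((m : ℝ) + 1)
      rw [div_le_iff₀ hm, add_mul x, one_div_mul_cancel hm.ne']
      nlinarith [Int.floor_le (((m : ℝ) + 1) * x)]
  · refine Eventually.of_forall fun m => ?_
    have hm : (0 : ℝ) < m + 1 := by positivity
    show x ≤ (⌊((m : ℝ) + 1) * x⌋ + 1 : ℝ) / (m + 1)
    rw [le_div_iff₀ hm]
    nlinarith [Int.lt_floor_add_one (((m : ℝ) + 1) * x)]

/-- Step functions on the grid are constant on the cells. -/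
lemma IsGridStep.eq_on_cell {n : ℕ} (hn : 0 < n) {g : ℝ → ℝ} (hg : IsGridStep n g) {i : ℕ}
    (hi : i < n) : ∀ x ∈ Ico ((i : ℝ) / n) (((i : ℝ) + 1) / n), g x = g ((i : ℝ) / n) := by
  have hn' : (0 : ℝ) < n := by exact_mod_cast hn
  have hi' : (i : ℝ) + 1 ≤ n := by exact_mod_cast hi
  refine hg.1.eq_of_no_jump (by positivity) ((div_le_one hn').2 hi') fun x hx hxj => ?_
  obtain ⟨j, rfl⟩ := hg.2 x hxj
  have h1 := (div_lt_div_iff_of_pos_right hn').1 hx.1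
  have h2 := (div_lt_div_iff_of_pos_right hn').1 hx.2
  have h1' : i < j := by exact_mod_cast h1
  have h2' : j < i + 1 := by exact_mod_cast h2
  omega

lemma IsGridStep.card_le_numJumps {n : ℕ} (hn : 0 < n) {g : ℝ → ℝ} (hg : IsGridStep n g) :
    ((Finset.Ico 1 n).filter fun i : ℕ => g ((i : ℝ) / n) ≠ g (((i - 1 : ℕ) : ℝ) / n)).card ≤
      numJumps g := by
  classical
  have hn' : (0 : ℝ) < n := by exact_mod_cast hn
  rw [← Set.ncard_coe_finset]
  refine Set.ncard_le_ncard_of_injOn (fun i : ℕ => (i : ℝ) / n) ?_ ?_ hg.1.finite_jumpSet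
  · intro i hi
    simp only [Finset.coe_filter, Finset.mem_Ico, Set.mem_ofPred_eq] at hi
    obtain ⟨⟨h1, h2⟩, hne⟩ := hi
    have h1' : (0 : ℝ) < i := by exact_mod_cast h1
    have h2' : (i : ℝ) < n := by exact_mod_cast h2
    have hcast : ((i - 1 : ℕ) : ℝ) = (i : ℝ) - 1 := by rw [Nat.cast_sub h1]; simp
    refine mem_jumpSet_of_left_const (a := ((i - 1 : ℕ) : ℝ) / n)
      ⟨by positivity, (div_lt_one hn').2 h2'⟩ ?_ ?_ hne
    · rw [hcast]; exact div_lt_div_of_pos_right (by linarith) hn'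
    · have := hg.eq_on_cell hn (i := i - 1) (by omega)
      rw [hcast, sub_add_cancel] at this
      rw [hcast]; exact this
  · intro i _ j _ hij
    have : (i : ℝ) = j := by
      simpa [div_left_inj' hn'.ne'] using hij
    exact_mod_cast this

/-! ### The multiscale constraint in grid coordinates, and the distance of feasible candidates -/

/-- Extension of a finite sequence by zero. -/
def extendZero {n : ℕ} (y : Fin n → ℝ) (i : ℕ) : ℝ := if h : i < n then y ⟨i, h⟩ else 0

@[simp] lemma extendZero_coe {n : ℕ} (y : Fin n → ℝ) (i : Fin n) : extendZero y i = y i := by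
  simp [extendZero]

lemma sum_indicator_grid {n : ℕ} (hn : 0 < n) (A : ℕ → ℝ) {p q : ℕ} (hq : q ≤ n) :
    ∑ i : Fin n, (Ico ((p : ℝ) / n) ((q : ℝ) / n)).indicator (fun _ => A i) ((i : ℝ) / n) =
      ∑ i ∈ Finset.Ico p q, A i := by
  classical
  have hn' : (0 : ℝ) < n := by exact_mod_cast hn
  have h1 : ∀ i : ℕ, (Ico ((p : ℝ) / n) ((q : ℝ) / n)).indicator (fun _ => A i) ((i : ℝ) / n) =
      if p ≤ i ∧ i < q then A i else 0 := by
    intro i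
    rw [Set.indicator_apply]
    congr 1
    rw [mem_Ico, div_le_div_iff_of_pos_right hn', div_lt_div_iff_of_pos_right hn']
    norm_cast
  rw [Fin.sum_univ_eq_sum_range (fun i : ℕ =>
    (Ico ((p : ℝ) / n) ((q : ℝ) / n)).indicator (fun _ => A i) ((i : ℝ) / n))]
  simp_rw [h1]
  rw [← Finset.sum_filter]
  congr 1
  ext i
  simp only [Finset.mem_filter, Finset.mem_range, Finset.mem_Ico]
  omega

lemma IsNormalSystem.exists_grid {c : ℝ} {n : ℕ} (hn : 0 < n) {𝓘 : Set (ℝ × ℝ)}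
    (h : IsNormalSystem c n 𝓘) {I : ℝ × ℝ} (hI : I ∈ 𝓘) :
    ∃ p q : ℕ, p < q ∧ q ≤ n ∧ I = ((p : ℝ) / n, (q : ℝ) / n) := by
  have hn' : (0 : ℝ) < n := by exact_mod_cast hn
  obtain ⟨p, q, hp, hq, h1, h2⟩ := h.grid I hI
  refine ⟨p, q, ?_, hq, Prod.ext h1 h2⟩
  have := (h.isInterval I hI).2.1
  rw [h1, h2, div_lt_div_iff_of_pos_right hn'] at this
  exact_mod_cast this

/-- Every grid interval contains a comparable interval of the system. -/
lemma IsNormalSystem.exists_subinterval {c : ℝ} {n : ℕ} (hn : 0 < n) (hc : 1 < c)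
    {𝓘 : Set (ℝ × ℝ)} (h : IsNormalSystem c n 𝓘) {a b : ℕ} (hab : a < b) (hb : b ≤ n) :
    ∃ p q : ℕ, a ≤ p ∧ p < q ∧ q ≤ b ∧ ((p : ℝ) / n, (q : ℝ) / n) ∈ 𝓘 ∧
      (b : ℝ) - a ≤ c * ((q : ℝ) - p) := by
  have hn' : (0 : ℝ) < n := by exact_mod_cast hn
  have hc0 : 0 < c := by linarith
  have hab' : (a : ℝ) < b := by exact_mod_cast hab
  by_cases hlen : c < (b : ℝ) - a
  · obtain ⟨I, hI, h1, h2, h3⟩ := h.rich (a / n) (b / n) (by positivity)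
      (div_lt_div_of_pos_right hab' hn') ((div_le_one hn').2 (by exact_mod_cast hb))
      (by rw [← sub_div]; exact div_lt_div_of_pos_right hlen hn')
    obtain ⟨p, q, hpq, hq, rfl⟩ := h.exists_grid hn hI
    dsimp only at h1 h2 h3
    rw [div_le_div_iff_of_pos_right hn'] at h1 h2
    refine ⟨p, q, by exact_mod_cast h1, hpq, by exact_mod_cast h2, hI, ?_⟩
    rw [← sub_div, ← sub_div, ← mul_div_assoc, div_le_div_iff_of_pos_right hn',
      inv_mul_le_iff₀ hc0] at h3
    exact h3
  -- At length at most `c` cells richness says nothing, but a single cell is already long enough.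
  · refine ⟨a, a + 1, le_rfl, by omega, hab, ?_, ?_⟩
    · have := h.cells a (by omega)
      push_cast
      exact this
    · push_cast
      push Not at hlen
      linarith

lemma multiscaleStat_le_iff {n : ℕ} {𝓘 : Set (ℝ × ℝ)} {s : ℝ × ℝ → ℝ} {y : Fin n → ℝ}
    {g : ℝ → ℝ} {η : ℝ} :
    multiscaleStat n 𝓘 s y g ≤ (η : EReal) ↔
      ∀ I ∈ 𝓘, ∀ v : ℝ, (∀ x ∈ Ico I.1 I.2, g x = v) →
        |∑ i : Fin n, (Ico I.1 I.2).indicator (fun _ => y i - v) ((i : ℝ) / n)|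
          / √((n : ℝ) * (I.2 - I.1)) - s I ≤ η := by
  simp only [multiscaleStat, iSup_le_iff, EReal.coe_le_coe_iff]

lemma local_stat_eq {n : ℕ} (hn : 0 < n) (y : Fin n → ℝ) (v : ℝ) {p q : ℕ} (hq : q ≤ n) :
    |∑ i : Fin n, (Ico ((p : ℝ) / n) ((q : ℝ) / n)).indicator (fun _ => y i - v) ((i : ℝ) / n)|
        / √((n : ℝ) * ((q : ℝ) / n - (p : ℝ) / n)) =
      |∑ i ∈ Finset.Ico p q, (extendZero y i - v)| / √((q : ℝ) - p) := by
  have hn' : (0 : ℝ) < n := by exact_mod_cast hn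
  have h1 := sum_indicator_grid hn (fun i => extendZero y i - v) (p := p) hq
  simp only [extendZero_coe] at h1
  rw [h1, ← sub_div, mul_div_cancel₀ _ hn'.ne']

lemma IsNormalSystem.stat_le_iff {c : ℝ} {n : ℕ} (hn : 0 < n) {𝓘 : Set (ℝ × ℝ)}
    (h𝓘 : IsNormalSystem c n 𝓘) {s : ℝ × ℝ → ℝ} {y : Fin n → ℝ} {g : ℝ → ℝ} {η : ℝ} :
    multiscaleStat n 𝓘 s y g ≤ (η : EReal) ↔
      ∀ p q : ℕ, p < q → q ≤ n → ((p : ℝ) / n, (q : ℝ) / n) ∈ 𝓘 → ∀ v : ℝ,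
        (∀ x ∈ Ico ((p : ℝ) / n) ((q : ℝ) / n), g x = v) →
        |∑ i ∈ Finset.Ico p q, (extendZero y i - v)| / √((q : ℝ) - p)
          - s ((p : ℝ) / n, (q : ℝ) / n) ≤ η := by
  rw [multiscaleStat_le_iff]
  constructor
  · intro h p q hpq hq hI v hv
    rw [← local_stat_eq hn y v hq]
    exact h _ hI v hv
  · intro h I hI v hv
    obtain ⟨p, q, hpq, hq, rfl⟩ := h𝓘.exists_grid hn hI
    have := h p q hpq hq hI v hv
    rw [← local_stat_eq hn y v hq] at this
    exact this

lemma eq_on_run {n : ℕ} (hn : 0 < n) {g : ℝ → ℝ} (hg : IsGridStep n g) {a b : ℕ} (hb : b ≤ n)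
    {v : ℝ} (hrun : ∀ i, a ≤ i → i < b → g ((i : ℝ) / n) = v) :
    ∀ x ∈ Ico ((a : ℝ) / n) ((b : ℝ) / n), g x = v := by
  have hn' : (0 : ℝ) < n := by exact_mod_cast hn
  intro x hx
  have hb' : (b : ℝ) ≤ n := by exact_mod_cast hb
  obtain ⟨i, hi, hxi⟩ := exists_cell hn
    (x := x) ⟨le_trans (by positivity) hx.1, hx.2.trans_le ((div_le_one hn').2 hb')⟩
  have h1 := hx.1.trans_lt hxi.2
  have h2 := hxi.1.trans_lt hx.2
  rw [div_lt_div_iff_of_pos_right hn'] at h1 h2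
  have h1' : a < i + 1 := by exact_mod_cast h1
  have h2' : i < b := by exact_mod_cast h2
  rw [hg.eq_on_cell hn hi x hxi, hrun i (by omega) h2']

/-- Two feasible candidates are close on every interval on which both are constant. -/
lemma IsNormalSystem.run_bound {c : ℝ} {n : ℕ} (hn : 0 < n) (hc : 1 < c) {𝓘 : Set (ℝ × ℝ)}
    (h𝓘 : IsNormalSystem c n 𝓘) {s₁ s₂ : ℝ × ℝ → ℝ} {y : Fin n → ℝ} {g₁ g₂ : ℝ → ℝ} {η R : ℝ}
    (hg₁ : IsGridStep n g₁) (hg₂ : IsGridStep n g₂)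
    (h₁ : multiscaleStat n 𝓘 s₁ y g₁ ≤ (η : EReal))
    (h₂ : multiscaleStat n 𝓘 s₂ y g₂ ≤ (η : EReal))
    (hs₁ : ∀ I ∈ 𝓘, η + s₁ I ≤ R) (hs₂ : ∀ I ∈ 𝓘, η + s₂ I ≤ R)
    {a b : ℕ} (hab : a < b) (hb : b ≤ n)
    (hrun : ∀ i, a ≤ i → i < b → g₁ ((i : ℝ) / n) = g₁ ((a : ℝ) / n) ∧
      g₂ ((i : ℝ) / n) = g₂ ((a : ℝ) / n)) :
    ((b : ℝ) - a) * (g₁ ((a : ℝ) / n) - g₂ ((a : ℝ) / n)) ^ 2 ≤ 4 * c * R ^ 2 := by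
  obtain ⟨p, q, hap, hpq, hqb, hI, hlen⟩ := h𝓘.exists_subinterval hn hc hab hb
  have hpq' : (0 : ℝ) < (q : ℝ) - p := by
    have : (p : ℝ) < q := by exact_mod_cast hpq
    linarith
  have key : ∀ (s : ℝ × ℝ → ℝ) (g : ℝ → ℝ), IsGridStep n g →
      multiscaleStat n 𝓘 s y g ≤ (η : EReal) → (∀ I ∈ 𝓘, η + s I ≤ R) →
      (∀ i, a ≤ i → i < b → g ((i : ℝ) / n) = g ((a : ℝ) / n)) →
      |∑ i ∈ Finset.Ico p q, (extendZero y i - g ((a : ℝ) / n))| ≤ R * √((q : ℝ) - p) := by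
    intro s g hg h hs hr
    have h3 := (h𝓘.stat_le_iff hn).1 h p q hpq (hqb.trans hb) hI (g ((a : ℝ) / n))
      (eq_on_run hn hg (hqb.trans hb) fun i h1 h2 => hr i (by omega) (by omega))
    have h4 := hs _ hI
    rw [← div_le_iff₀ (Real.sqrt_pos.2 hpq')]
    linarith
  have k₁ := key s₁ g₁ hg₁ h₁ hs₁ fun i h1 h2 => (hrun i h1 h2).1
  have k₂ := key s₂ g₂ hg₂ h₂ hs₂ fun i h1 h2 => (hrun i h1 h2).2
  set v₁ := g₁ ((a : ℝ) / n)
  set v₂ := g₂ ((a : ℝ) / n)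
  -- The data cancel, so the two constraints on `[p, q)` bound the gap of the two constants; `hlen`
  -- then carries the bound over to `[a, b)` at the cost of a factor `c`.
  have hdiff : ((q : ℝ) - p) * (v₁ - v₂) = ∑ i ∈ Finset.Ico p q, (extendZero y i - v₂) -
      ∑ i ∈ Finset.Ico p q, (extendZero y i - v₁) := by
    rw [← Finset.sum_sub_distrib]
    simp only [sub_sub_sub_cancel_left, Finset.sum_const, Nat.card_Ico, nsmul_eq_mul]
    rw [Nat.cast_sub hpq.le]
  have h5 : |((q : ℝ) - p) * (v₁ - v₂)| ≤ 2 * R * √((q : ℝ) - p) := by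
    rw [hdiff]
    refine (abs_sub _ _).trans ?_
    linarith
  have h6 : (((q : ℝ) - p) * (v₁ - v₂)) ^ 2 ≤ (2 * R * √((q : ℝ) - p)) ^ 2 := by
    rw [← sq_abs]
    exact pow_le_pow_left₀ (abs_nonneg _) h5 2
  rw [mul_pow, mul_pow, mul_pow, Real.sq_sqrt hpq'.le] at h6
  have h7 : ((q : ℝ) - p) * (v₁ - v₂) ^ 2 ≤ 4 * R ^ 2 := by
    refine le_of_mul_le_mul_left ?_ hpq'
    nlinarith
  calc ((b : ℝ) - a) * (v₁ - v₂) ^ 2 ≤ c * ((q : ℝ) - p) * (v₁ - v₂) ^ 2 :=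
        mul_le_mul_of_nonneg_right hlen (sq_nonneg _)
    _ = c * (((q : ℝ) - p) * (v₁ - v₂) ^ 2) := by ring
    _ ≤ c * (4 * R ^ 2) := mul_le_mul_of_nonneg_left h7 (by linarith)
    _ = _ := by ring

/-- The index range splits into maximal runs on which both sequences are constant, one more than
there are changes, and each run costs at most `B`. The induction peels off the last run. -/
lemma sum_sq_le_of_run_bound (w₁ w₂ : ℕ → ℝ) {B : ℝ} (hB : 0 ≤ B) (n : ℕ)
    (hrun : ∀ a b : ℕ, a < b → b ≤ n → (∀ i, a ≤ i → i < b → w₁ i = w₁ a ∧ w₂ i = w₂ a) →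
      ((b : ℝ) - a) * (w₁ a - w₂ a) ^ 2 ≤ B) :
    ∑ i ∈ Finset.range n, (w₁ i - w₂ i) ^ 2 ≤
      (((Finset.Ico 1 n).filter fun i => w₁ i ≠ w₁ (i - 1) ∨ w₂ i ≠ w₂ (i - 1)).card + 1) * B := by
  classical
  induction n using Nat.strong_induction_on with
  | _ n ih =>
  rcases Nat.eq_zero_or_pos n with rfl | hn
  · simpa using hB
  set P : ℕ → Prop := fun i => i = 0 ∨ (w₁ i ≠ w₁ (i - 1) ∨ w₂ i ≠ w₂ (i - 1)) with hP
  set a := Nat.findGreatest P (n - 1) with ha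
  have haP : P a := Nat.findGreatest_spec (P := P) (Nat.zero_le _) (Or.inl rfl)
  have han : a ≤ n - 1 := Nat.findGreatest_le _
  have hnot : ∀ i, a < i → i < n → w₁ i = w₁ (i - 1) ∧ w₂ i = w₂ (i - 1) := by
    intro i h1 h2
    have := Nat.findGreatest_is_greatest (P := P) h1 (by omega)
    simp only [hP, not_or, not_not] at this
    exact this.2
  have hc : ∀ i, a ≤ i → i < n → w₁ i = w₁ a ∧ w₂ i = w₂ a := fun i h1 h2 =>
    ⟨eq_of_forall_succ_eq w₁ (fun j h3 h4 => (hnot j h3 h4).1) i h1 h2,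
      eq_of_forall_succ_eq w₂ (fun j h3 h4 => (hnot j h3 h4).2) i h1 h2⟩
  have hlast : ∑ i ∈ Finset.Ico a n, (w₁ i - w₂ i) ^ 2 ≤ B := by
    refine le_trans (le_of_eq ?_) (hrun a n (by omega) le_rfl hc)
    rw [Finset.sum_congr rfl (g := fun _ => (w₁ a - w₂ a) ^ 2)]
    · rw [Finset.sum_const, Nat.card_Ico, nsmul_eq_mul, Nat.cast_sub (by omega)]
    · intro i hi
      rw [Finset.mem_Ico] at hi
      rw [(hc i hi.1 hi.2).1, (hc i hi.1 hi.2).2]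
  rw [← Finset.sum_range_add_sum_Ico _ (show a ≤ n by omega)]
  rcases Nat.eq_zero_or_pos a with h0 | hpos
  · rw [h0] at hlast ⊢
    simp only [Finset.range_zero, Finset.sum_empty, zero_add]
    nlinarith [Nat.cast_nonneg (α := ℝ) ((Finset.Ico 1 n).filter fun i =>
      w₁ i ≠ w₁ (i - 1) ∨ w₂ i ≠ w₂ (i - 1)).card]
  · have hih := ih a (by omega) fun a' b' h1 h2 h3 => hrun a' b' h1 (by omega) h3
    have hcard : ((Finset.Ico 1 a).filter fun i =>
          w₁ i ≠ w₁ (i - 1) ∨ w₂ i ≠ w₂ (i - 1)).card + 1 ≤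
        ((Finset.Ico 1 n).filter fun i => w₁ i ≠ w₁ (i - 1) ∨ w₂ i ≠ w₂ (i - 1)).card := by
      rw [← Finset.card_insert_of_notMem (a := a) (by simp)]
      apply Finset.card_le_card
      intro i hi
      rw [Finset.mem_insert, Finset.mem_filter, Finset.mem_Ico] at hi
      rw [Finset.mem_filter, Finset.mem_Ico]
      rcases hi with rfl | hi
      · exact ⟨by omega, haP.resolve_left (by omega)⟩
      · exact ⟨by omega, hi.2⟩
    have hcard' : (((Finset.Ico 1 a).filter fun i =>
          w₁ i ≠ w₁ (i - 1) ∨ w₂ i ≠ w₂ (i - 1)).card : ℝ) + 1 ≤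
        ((Finset.Ico 1 n).filter fun i => w₁ i ≠ w₁ (i - 1) ∨ w₂ i ≠ w₂ (i - 1)).card := by
      exact_mod_cast hcard
    nlinarith

/-! ### The squared `L²` distance -/

lemma lqDist_two_sq (f g : ℝ → ℝ) :
    lqDist 2 f g ^ 2 = ∫⁻ x in Ico (0 : ℝ) 1, ENNReal.ofReal ((f x - g x) ^ 2) := by
  rw [lqDist, eLpNorm_eq_lintegral_rpow_enorm_toReal (by norm_num) (by norm_num)]
  simp only [ENNReal.toReal_ofNat, ENNReal.rpow_ofNat]
  rw [← ENNReal.rpow_natCast, ← ENNReal.rpow_mul]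
  norm_num
  refine lintegral_congr fun x => ?_
  rw [← ofReal_norm, ← ENNReal.ofReal_pow (norm_nonneg _), Real.norm_eq_abs, sq_abs]

lemma lintegral_eq_sum_cells {n : ℕ} (hn : 0 < n) (F : ℝ → ℝ≥0∞) :
    ∫⁻ x in Ico (0 : ℝ) 1, F x =
      ∑ i ∈ Finset.range n, ∫⁻ x in Ico ((i : ℝ) / n) (((i : ℝ) + 1) / n), F x := by
  have hn' : (0 : ℝ) < n := by exact_mod_cast hn
  rw [← lintegral_biUnion_finset]
  · congr 2
    ext x
    simp only [Finset.mem_range, mem_iUnion, exists_prop]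
    refine ⟨fun hx => exists_cell hn hx, ?_⟩
    rintro ⟨i, hi, hx⟩
    have hi' : (i : ℝ) + 1 ≤ n := by exact_mod_cast hi
    exact ⟨le_trans (by positivity) hx.1, hx.2.trans_le ((div_le_one hn').2 hi')⟩
  · intro i _ j _ hij
    refine Set.disjoint_left.2 fun x hxi hxj => hij ?_
    have h1 := hxi.1.trans_lt hxj.2
    have h2 := hxj.1.trans_lt hxi.2
    rw [div_lt_div_iff_of_pos_right hn'] at h1 h2
    have h1' : i < j + 1 := by exact_mod_cast h1
    have h2' : j < i + 1 := by exact_mod_cast h2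
    omega
  · exact fun _ _ => measurableSet_Ico

lemma volume_cell (n i : ℕ) :
    volume (Ico ((i : ℝ) / n) (((i : ℝ) + 1) / n)) = ENNReal.ofReal (1 / n) := by
  rw [Real.volume_Ico]
  congr 1
  ring

lemma IsGridStep.lqDist_two_sq {n : ℕ} (hn : 0 < n) {g₁ g₂ : ℝ → ℝ}
    (hg₁ : IsGridStep n g₁) (hg₂ : IsGridStep n g₂) :
    lqDist 2 g₁ g₂ ^ 2 = ENNReal.ofReal
      ((∑ i ∈ Finset.range n, (g₁ ((i : ℝ) / n) - g₂ ((i : ℝ) / n)) ^ 2) * (1 / n)) := by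
  rw [ChangePoint.lqDist_two_sq, lintegral_eq_sum_cells hn, Finset.sum_mul,
    ENNReal.ofReal_sum_of_nonneg fun i _ => by positivity]
  refine Finset.sum_congr rfl fun i hi => ?_
  rw [Finset.mem_range] at hi
  rw [setLIntegral_congr_fun (g := fun _ => ENNReal.ofReal
    ((g₁ ((i : ℝ) / n) - g₂ ((i : ℝ) / n)) ^ 2)) measurableSet_Ico]
  · rw [setLIntegral_const, volume_cell, ENNReal.ofReal_mul (sq_nonneg _)]
  · intro x hx
    simp only
    rw [hg₁.eq_on_cell hn hi x hx, hg₂.eq_on_cell hn hi x hx]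

/-- Two feasible candidates with few jumps are close in `L²`. -/
lemma IsNormalSystem.lqDist_feasible_le {c : ℝ} {n : ℕ} (hn : 0 < n) (hc : 1 < c)
    {𝓘 : Set (ℝ × ℝ)} (h𝓘 : IsNormalSystem c n 𝓘) {s₁ s₂ : ℝ × ℝ → ℝ} {y : Fin n → ℝ}
    {g₁ g₂ : ℝ → ℝ} {η R : ℝ} (hg₁ : IsGridStep n g₁) (hg₂ : IsGridStep n g₂)
    (h₁ : multiscaleStat n 𝓘 s₁ y g₁ ≤ (η : EReal))
    (h₂ : multiscaleStat n 𝓘 s₂ y g₂ ≤ (η : EReal))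
    (hs₁ : ∀ I ∈ 𝓘, η + s₁ I ≤ R) (hs₂ : ∀ I ∈ 𝓘, η + s₂ I ≤ R) :
    lqDist 2 g₁ g₂ ^ 2 ≤
      ENNReal.ofReal ((numJumps g₁ + numJumps g₂ + 1) * (4 * c * R ^ 2) * (1 / n)) := by
  classical
  rw [hg₁.lqDist_two_sq hn hg₂]
  have hB : 0 ≤ 4 * c * R ^ 2 := by
    have : 0 < c := by linarith
    positivity
  apply ENNReal.ofReal_le_ofReal
  refine mul_le_mul_of_nonneg_right ?_ (by positivity)
  refine (sum_sq_le_of_run_bound (fun i => g₁ ((i : ℝ) / n)) (fun i => g₂ ((i : ℝ) / n)) hB n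
    fun a b hab hb hrun => h𝓘.run_bound hn hc hg₁ hg₂ h₁ h₂ hs₁ hs₂ hab hb hrun).trans ?_
  refine mul_le_mul_of_nonneg_right ?_ hB
  rw [Finset.filter_or]
  have h3 := Finset.card_union_le
    ((Finset.Ico 1 n).filter fun i : ℕ => g₁ ((i : ℝ) / n) ≠ g₁ (((i - 1 : ℕ) : ℝ) / n))
    ((Finset.Ico 1 n).filter fun i : ℕ => g₂ ((i : ℝ) / n) ≠ g₂ (((i - 1 : ℕ) : ℝ) / n))
  have h4 := hg₁.card_le_numJumps hn
  have h5 := hg₂.card_le_numJumps hn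
  have h6 := h3.trans (Nat.add_le_add h4 h5)
  have h7 : ((_ : ℕ) : ℝ) ≤ _ := Nat.cast_le.2 h6
  push_cast at h7
  linarith

/-! ### Cell means and the oracle -/

lemma card_change_le {φ : ℕ → ℕ} (hφ : Monotone φ) (n : ℕ) :
    ((Finset.range n).filter fun i => φ i ≠ φ (i + 1)).card ≤ φ n - φ 0 := by
  induction n with
  | zero => simp
  | succ n ih =>
    rw [Finset.range_add_one, Finset.filter_insert]
    have h1 := hφ (Nat.zero_le n)
    have h2 := hφ (Nat.le_succ n)
    simp only [Nat.succ_eq_add_one] at h2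
    split_ifs with h
    · refine (Finset.card_insert_le _ _).trans ?_
      omega
    · omega

lemma cell_subset {n i : ℕ} (hi : i < n) :
    Ico ((i : ℝ) / n) (((i : ℝ) + 1) / n) ⊆ Ico (0 : ℝ) 1 := by
  have hn' : (0 : ℝ) < n := by exact_mod_cast (Nat.zero_le i).trans_lt hi
  have hi' : (i : ℝ) + 1 ≤ n := by exact_mod_cast hi
  exact Ico_subset_Ico (by positivity) ((div_le_one hn').2 hi')

lemma ae_abs_le_of_eLpNorm_top_le {f : ℝ → ℝ} {L : ℝ} (hL : 0 ≤ L)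
    (hf : eLpNorm f ∞ (volume.restrict (Ico (0 : ℝ) 1)) ≤ ENNReal.ofReal L) :
    ∀ᵐ x ∂(volume.restrict (Ico (0 : ℝ) 1)), |f x| ≤ L := by
  rw [eLpNorm_exponent_top] at hf
  filter_upwards [ae_le_eLpNormEssSup (f := f) (μ := volume.restrict (Ico (0 : ℝ) 1))] with x hx
  have := hx.trans hf
  rw [← ofReal_norm] at this
  exact (ENNReal.ofReal_le_ofReal_iff hL).1 this

/-- The mean of `f` on the cell `[i/n, (i+1)/n)`. -/
noncomputable def cellMean (n : ℕ) (f : ℝ → ℝ) (i : ℕ) : ℝ :=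
  (n : ℝ) * ∫ x in Ico ((i : ℝ) / n) (((i : ℝ) + 1) / n), f x

section cells

variable {n : ℕ} {f : ℝ → ℝ} {L : ℝ}

lemma cell_integrable (hf : IsCadlag f)
    (hL : ∀ᵐ x ∂(volume.restrict (Ico (0 : ℝ) 1)), |f x| ≤ L) {i : ℕ} (hi : i < n) :
    AEStronglyMeasurable f (volume.restrict (Ico ((i : ℝ) / n) (((i : ℝ) + 1) / n))) ∧
      ∀ᵐ x ∂(volume.restrict (Ico ((i : ℝ) / n) (((i : ℝ) + 1) / n))), |f x| ≤ L :=
  ⟨hf.aestronglyMeasurable.mono_measure (Measure.restrict_mono (cell_subset hi) le_rfl),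
    ae_mono (Measure.restrict_mono (cell_subset hi) le_rfl) hL⟩

lemma volume_real_cell (n i : ℕ) :
    (volume.restrict (Ico ((i : ℝ) / n) (((i : ℝ) + 1) / n))).real univ = 1 / n := by
  rw [Measure.real, Measure.restrict_apply_univ, volume_cell, ENNReal.toReal_ofReal (by positivity)]

lemma abs_cellMean_le (hL : ∀ᵐ x ∂(volume.restrict (Ico (0 : ℝ) 1)), |f x| ≤ L)
    {i : ℕ} (hi : i < n) : |cellMean n f i| ≤ L := by
  have hn' : (0 : ℝ) < n := by exact_mod_cast (Nat.zero_le i).trans_lt hi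
  have hb : ∀ᵐ x ∂(volume.restrict (Ico ((i : ℝ) / n) (((i : ℝ) + 1) / n))), ‖f x‖ ≤ L :=
    ae_mono (Measure.restrict_mono (cell_subset hi) le_rfl) hL
  have h := norm_integral_le_of_norm_le_const hb
  rw [volume_real_cell, Real.norm_eq_abs] at h
  rw [cellMean, abs_mul, abs_of_pos hn']
  calc (n : ℝ) * |∫ x in Ico ((i : ℝ) / n) (((i : ℝ) + 1) / n), f x| ≤ n * (L * (1 / n)) :=
        mul_le_mul_of_nonneg_left h hn'.le
    _ = L := by field_simp

/-- Jensen's inequality on a cell. -/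
lemma sq_cellMean_sub_le (hf : IsCadlag f)
    (hL : ∀ᵐ x ∂(volume.restrict (Ico (0 : ℝ) 1)), |f x| ≤ L) {i : ℕ} (hi : i < n) (v : ℝ) :
    (cellMean n f i - v) ^ 2 ≤ n * (∫⁻ x in Ico ((i : ℝ) / n) (((i : ℝ) + 1) / n),
      ENNReal.ofReal ((f x - v) ^ 2)).toReal := by
  have hn' : (0 : ℝ) < n := by exact_mod_cast (Nat.zero_le i).trans_lt hi
  obtain ⟨hm, hb⟩ := cell_integrable hf hL hi
  set ν := volume.restrict (Ico ((i : ℝ) / n) (((i : ℝ) + 1) / n)) with hν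
  have : IsFiniteMeasure ν := ⟨by
    rw [hν, Measure.restrict_apply_univ, volume_cell]; exact ENNReal.ofReal_lt_top⟩
  have hi1 : Integrable f ν := Integrable.of_bound hm L hb
  have hi2 : Integrable (fun x => (f x - v) ^ 2) ν := by
    refine Integrable.of_bound ((hm.sub aestronglyMeasurable_const).pow 2) ((L + |v|) ^ 2) ?_
    filter_upwards [hb] with x hx
    rw [Real.norm_eq_abs, abs_pow]
    exact pow_le_pow_left₀ (abs_nonneg _) ((abs_sub _ _).trans (by gcongr)) 2
  rw [← integral_eq_lintegral_of_nonneg_ae (Eventually.of_forall fun x => sq_nonneg _)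
    hi2.aestronglyMeasurable]
  have huniv : ν.real univ = 1 / n := volume_real_cell n i
  set M := cellMean n f i - v with hM
  have hI : ∫ x, (f x - v) ∂ν = M / n := by
    rw [integral_sub hi1 (integrable_const _), integral_const, huniv, hM, cellMean, ← hν]
    simp only [smul_eq_mul]
    field_simp
  -- `M` is the average of `f - v` over the cell, so this is nonnegativity of the variance.
  have h0 : 0 ≤ ∫ x, ((f x - v) - M) ^ 2 ∂ν := integral_nonneg fun x => sq_nonneg _
  have h1 : ∫ x, ((f x - v) - M) ^ 2 ∂ν =
      ∫ x, (f x - v) ^ 2 ∂ν - 2 * M * (M / n) + M ^ 2 * (1 / n) := by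
    have : ∀ x, ((f x - v) - M) ^ 2 = (f x - v) ^ 2 - 2 * M * (f x - v) + M ^ 2 := fun x => by ring
    simp_rw [this]
    have hi3 : Integrable (fun x => 2 * M * (f x - v)) ν :=
      (hi1.sub (integrable_const v)).const_mul _
    have hi4 : Integrable (fun x => (f x - v) ^ 2 - 2 * M * (f x - v)) ν := hi2.sub hi3
    rw [integral_add hi4 (integrable_const _), integral_sub hi2 hi3,
      integral_const_mul, hI, integral_const, huniv]
    simp only [smul_eq_mul]
    ring
  rw [h1] at h0
  have h2 : M ^ 2 / n ≤ ∫ x, (f x - v) ^ 2 ∂ν := by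
    have : 2 * M * (M / n) - M ^ 2 * (1 / n) = M ^ 2 / n := by ring
    linarith
  rwa [div_le_iff₀ hn', mul_comm] at h2

end cells

/-- Each forbidden coincidence is a linear equation in `θ` with nonzero coefficient and excludes one
value. The perturbed values let the oracle differ between a modified cell and every other cell. -/
lemma exists_perturbation (n : ℕ) (m v : ℕ → ℝ) {κ : ℝ} (hκ : 0 < κ) :
    ∃ θ ∈ Ioo 0 κ, ∀ i < n, ∀ j < n, i ≠ j →
      m i + θ * (i + 1) ≠ m j + θ * (j + 1) ∧ m i + θ * (i + 1) ≠ v j := by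
  classical
  set T : Finset (ℕ × ℕ) := Finset.range n ×ˢ Finset.range n
  obtain ⟨θ, hθ, hnot⟩ := (Ioo_infinite hκ).exists_notMem_finset
    ((T.image fun p => (m p.2 - m p.1) / ((p.1 : ℝ) - p.2)) ∪
      (T.image fun p => (v p.2 - m p.1) / ((p.1 : ℝ) + 1)))
  refine ⟨θ, hθ, fun i hi j hj hij => ⟨fun h => hnot ?_, fun h => hnot ?_⟩⟩
  · rw [Finset.mem_union, Finset.mem_image]
    refine Or.inl ⟨(i, j), by simp [T, hi, hj], ?_⟩
    have : (i : ℝ) - j ≠ 0 := sub_ne_zero.2 (by exact_mod_cast hij)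
    simp only
    rw [div_eq_iff this]
    linarith
  · rw [Finset.mem_union, Finset.mem_image, Finset.mem_image]
    refine Or.inr ⟨(i, j), by simp [T, hi, hj], ?_⟩
    have : (i : ℝ) + 1 ≠ 0 := by positivity
    simp only
    rw [div_eq_iff this]
    linarith

/-- The oracle: a step function on the grid with few jumps, close to `f`, and with small bias on
every grid interval on which it is constant. -/
lemma exists_oracle {n : ℕ} (hn : 0 < n) {f g : ℝ → ℝ} {L D t : ℝ} {k : ℕ} (hf : IsCadlag f)
    (hL0 : 0 ≤ L) (hL : ∀ᵐ x ∂(volume.restrict (Ico (0 : ℝ) 1)), |f x| ≤ L)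
    (hg : IsStep g) (hk : numJumps g ≤ k) (hD0 : 0 ≤ D)
    (hD : lqDist 2 f g ^ 2 ≤ ENNReal.ofReal D) (ht : 0 < t) :
    ∃ h, IsGridStep n h ∧ (numJumps h : ℝ) ≤ 2 * (k + n / t * D) ∧
      lqDist 2 f h ^ 2 ≤ ENNReal.ofReal (D + (k + n / t * D) * ((2 * L + 1) ^ 2 * (1 / n))) ∧
      ∀ p q : ℕ, p < q → q ≤ n → ∀ v : ℝ, (∀ x ∈ Ico ((p : ℝ) / n) ((q : ℝ) / n), h x = v) →
        |∑ i ∈ Finset.Ico p q, (cellMean n f i - v)| ≤ √((q : ℝ) - p) * √t := by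
  classical
  have hn' : (0 : ℝ) < n := by exact_mod_cast hn
  set E : ℕ → ℝ≥0∞ := fun i => ∫⁻ x in Ico ((i : ℝ) / n) (((i : ℝ) + 1) / n),
    ENNReal.ofReal ((f x - g x) ^ 2) with hE
  set e : ℕ → ℝ := fun i => (E i).toReal with he
  have he0 : ∀ i, 0 ≤ e i := fun i => ENNReal.toReal_nonneg
  have hEsum : ∑ i ∈ Finset.range n, E i ≤ ENNReal.ofReal D := by
    rw [← lintegral_eq_sum_cells hn, ← lqDist_two_sq]; exact hD
  have hEfin : ∀ i < n, E i ≠ ∞ := fun i hi => ne_top_of_le_ne_top ENNReal.ofReal_ne_top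
    ((Finset.single_le_sum (fun _ _ => zero_le) (Finset.mem_range.2 hi)).trans hEsum)
  have hesum : ∑ i ∈ Finset.range n, e i ≤ D := by
    have := ENNReal.toReal_mono ENNReal.ofReal_ne_top hEsum
    rwa [ENNReal.toReal_sum fun i hi => hEfin i (Finset.mem_range.1 hi),
      ENNReal.toReal_ofReal hD0] at this
  set J := hg.finite_jumpSet.toFinset with hJ
  have hJcard : J.card ≤ k := by
    rw [← Set.ncard_eq_toFinset_card _ hg.finite_jumpSet]; exact hk
  set N : ℕ → ℕ := fun j => (J.filter fun x => x ≤ (j : ℝ) / n).card with hN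
  have hNmono : Monotone N := fun a b hab => by
    refine Finset.card_le_card (Finset.monotone_filter_right _ fun x _ hx => hx.trans ?_)
    exact div_le_div_of_nonneg_right (by exact_mod_cast hab) hn'.le
  -- The counter grows by one with each jump of `g` and with each amount `t / n` of squared error.
  -- The cells where its integer part changes, at most `U` in number, are the ones modified below.
  set u : ℕ → ℝ := fun j => N j + n / t * ∑ i ∈ Finset.range j, e i with hu
  have hsum_mono : Monotone fun j => ∑ i ∈ Finset.range j, e i := fun a b hab =>
    Finset.sum_le_sum_of_subset_of_nonneg (Finset.range_subset_range.2 hab) fun i _ _ => he0 i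
  have hnt : 0 < n / t := div_pos hn' ht
  have humono : Monotone u := fun a b hab =>
    add_le_add (by exact_mod_cast hNmono hab) (mul_le_mul_of_nonneg_left (hsum_mono hab) hnt.le)
  have hu0 : ∀ j, 0 ≤ u j := fun j =>
    add_nonneg (Nat.cast_nonneg _) (mul_nonneg hnt.le (Finset.sum_nonneg fun i _ => he0 i))
  set U : ℝ := k + n / t * D with hU
  have hun : u n ≤ U := by
    refine add_le_add ?_ (mul_le_mul_of_nonneg_left hesum hnt.le)
    exact_mod_cast (Finset.card_filter_le _ _).trans hJcard
  set φ : ℕ → ℕ := fun j => ⌊u j⌋₊ with hφ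
  have hφmono : Monotone φ := fun a b hab => Nat.floor_le_floor (humono hab)
  set ch : ℕ → Prop := fun i => φ i ≠ φ (i + 1) with hch
  set P := ((Finset.range n).filter fun i => ch i).card with hP
  have hPU : (P : ℝ) ≤ U := by
    have h1 : P ≤ φ n := (card_change_le hφmono n).trans (Nat.sub_le _ _)
    have h2 : (P : ℝ) ≤ φ n := by exact_mod_cast h1
    exact h2.trans ((Nat.floor_le (hu0 n)).trans hun)
  -- on a run without changes of the counter
  have hrun : ∀ a b : ℕ, a ≤ b → b ≤ n → φ a = φ b →
      (∀ x ∈ Ico ((a : ℝ) / n) ((b : ℝ) / n), g x = g ((a : ℝ) / n)) ∧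
      ∑ i ∈ Finset.Ico a b, (n : ℝ) * e i ≤ t := by
    intro a b hab hbn hfl
    -- Equal integer parts leave an increment below one: no room for a jump of `g`, nor for more
    -- than `t / n` of squared error.
    have hlt : u b < u a + 1 := by
      have h1 := Nat.floor_le (hu0 a)
      have h2 := Nat.lt_floor_add_one (u b)
      have h3 : (φ a : ℝ) = φ b := by exact_mod_cast hfl
      simp only [hφ] at h3
      linarith
    have h1 : (N a : ℝ) ≤ N b := by exact_mod_cast hNmono hab
    have h2 := mul_le_mul_of_nonneg_left (hsum_mono hab) hnt.le
    have hNab : N b = N a := by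
      have h4 : (N b : ℝ) < N a + 1 := by
        simp only [hu] at hlt h2
        linarith
      have h5 : N b < N a + 1 := by exact_mod_cast h4
      have := hNmono hab
      omega
    constructor
    · refine hg.eq_of_no_jump (by positivity)
        ((div_le_one hn').2 (by exact_mod_cast hbn)) fun x hx hxj => ?_
      have hsub : (J.filter fun x => x ≤ (a : ℝ) / n) ⊆ (J.filter fun x => x ≤ (b : ℝ) / n) :=
        Finset.monotone_filter_right _ fun x _ hx' => hx'.trans
          (div_le_div_of_nonneg_right (by exact_mod_cast hab) hn'.le)
      have heq := Finset.eq_of_subset_of_card_le hsub hNab.le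
      have hmem : x ∈ (J.filter fun x => x ≤ (b : ℝ) / n) := by
        rw [Finset.mem_filter, hJ, Set.Finite.mem_toFinset]
        exact ⟨hxj, hx.2.le⟩
      rw [← heq, Finset.mem_filter] at hmem
      exact absurd hx.1 (not_lt.2 hmem.2)
    · have h3 := Finset.sum_range_add_sum_Ico e hab
      simp only [hu, hNab] at hlt
      rw [← h3, mul_add] at hlt
      rw [← Finset.mul_sum]
      have h4 : n / t * ∑ i ∈ Finset.Ico a b, e i < 1 := by linarith
      rw [div_mul_eq_mul_div, div_lt_one ht] at h4
      exact h4.le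
  have hcell : ∀ i < n, ¬ ch i → ∀ x ∈ Ico ((i : ℝ) / n) (((i : ℝ) + 1) / n),
      g x = g ((i : ℝ) / n) := by
    intro i hi hchi
    have := (hrun i (i + 1) (by omega) hi (not_not.1 hchi)).1
    push_cast at this
    exact this
  set m := cellMean n f with hm
  have hκ : 0 < min √t 1 / n := div_pos (lt_min (Real.sqrt_pos.2 ht) one_pos) hn'
  obtain ⟨θ, hθ, hgen⟩ := exists_perturbation n m (fun i => g ((i : ℝ) / n)) hκ
  have hθi : ∀ i < n, 0 ≤ θ * ((i : ℝ) + 1) ∧ θ * ((i : ℝ) + 1) ≤ min √t 1 := by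
    intro i hi
    have hi' : (i : ℝ) + 1 ≤ n := by exact_mod_cast hi
    refine ⟨mul_nonneg hθ.1.le (by positivity), ?_⟩
    calc θ * ((i : ℝ) + 1) ≤ min √t 1 / n * n :=
          mul_le_mul hθ.2.le hi' (by positivity) hκ.le
      _ = _ := div_mul_cancel₀ _ hn'.ne'
  -- A modified cell gets its own mean, with a bias of only `θ (i + 1) ≤ min √t 1`; the other cells
  -- keep the value of `g`.
  set w : ℕ → ℝ := fun i => if ch i then m i + θ * (i + 1) else g ((i : ℝ) / n) with hw
  refine ⟨gridFun n w, isGridStep_gridFun hn w, ?_, ?_, ?_⟩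
  -- A jump at `i / n` requires that cell `i` or cell `i - 1` is modified, whence the factor 2.
  · have h1 : ((Finset.Ico 1 n).filter fun i => w i ≠ w (i - 1)) ⊆
        ((Finset.range n).filter fun i => ch i) ∪
          ((Finset.range n).filter fun i => ch i).image (· + 1) := by
      intro i hi
      rw [Finset.mem_filter, Finset.mem_Ico] at hi
      obtain ⟨⟨hi1, hin⟩, hne⟩ := hi
      rw [Finset.mem_union, Finset.mem_image]
      by_contra hcon
      push Not at hcon
      obtain ⟨hc1, hc2⟩ := hcon
      have hc1' : ¬ ch i := fun h => hc1 (Finset.mem_filter.2 ⟨Finset.mem_range.2 hin, h⟩)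
      have hc2' : ¬ ch (i - 1) := fun h =>
        hc2 (i - 1) (Finset.mem_filter.2 ⟨Finset.mem_range.2 (by omega), h⟩) (by omega)
      apply hne
      simp only [hw, hc1', hc2', if_false]
      have h3 : φ (i - 1) = φ (i + 1) := by
        simp only [hch, not_not] at hc1' hc2'
        rw [Nat.sub_add_cancel hi1] at hc2'
        rw [hc2', hc1']
      refine (hrun (i - 1) (i + 1) (by omega) hin h3).1 _ ⟨?_, ?_⟩
      · exact div_le_div_of_nonneg_right (by exact_mod_cast Nat.sub_le _ _) hn'.le
      · exact div_lt_div_of_pos_right (by exact_mod_cast Nat.lt_succ_self i) hn'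
    have h2 := (numJumps_gridFun_le hn w).trans ((Finset.card_le_card h1).trans
      ((Finset.card_union_le _ _).trans (Nat.add_le_add_left Finset.card_image_le _)))
    have h3 : (numJumps (gridFun n w) : ℝ) ≤ P + P := by exact_mod_cast h2
    linarith
  · rw [lqDist_two_sq, lintegral_eq_sum_cells hn]
    have hcellb : ∀ i ∈ Finset.range n, ∫⁻ x in Ico ((i : ℝ) / n) (((i : ℝ) + 1) / n),
        ENNReal.ofReal ((f x - gridFun n w x) ^ 2) ≤
          E i + if ch i then ENNReal.ofReal ((2 * L + 1) ^ 2 * (1 / n)) else 0 := by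
      intro i hi
      rw [Finset.mem_range] at hi
      by_cases hchi : ch i
      · rw [if_pos hchi]
        refine le_trans ?_ le_add_self
        calc ∫⁻ x in Ico ((i : ℝ) / n) (((i : ℝ) + 1) / n),
              ENNReal.ofReal ((f x - gridFun n w x) ^ 2)
            ≤ ∫⁻ x in Ico ((i : ℝ) / n) (((i : ℝ) + 1) / n),
              ENNReal.ofReal ((2 * L + 1) ^ 2) := by
              refine lintegral_mono_ae ?_
              filter_upwards [ae_mono (Measure.restrict_mono (cell_subset hi) le_rfl) hL,
                ae_restrict_mem measurableSet_Ico] with x hx hxc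
              refine ENNReal.ofReal_le_ofReal ?_
              rw [gridFun_of_mem hn w hxc, ← sq_abs]
              refine pow_le_pow_left₀ (abs_nonneg _) ?_ 2
              have h1 := abs_cellMean_le hL hi
              have h2 := hθi i hi
              have h3 := h2.2.trans (min_le_right _ _)
              simp only [hw, hchi, if_true]
              rw [abs_le] at hx h1 ⊢
              constructor <;> linarith [hx.1, hx.2, h1.1, h1.2, h2.1]
          _ = ENNReal.ofReal ((2 * L + 1) ^ 2 * (1 / n)) := by
              rw [setLIntegral_const, volume_cell, ENNReal.ofReal_mul (sq_nonneg _)]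
      · rw [if_neg hchi, add_zero]
        refine le_of_eq (setLIntegral_congr_fun measurableSet_Ico fun x hx => ?_)
        rw [gridFun_of_mem hn w hx, hcell i hi hchi x hx]
        simp only [hw, hchi, if_false]
    refine (Finset.sum_le_sum hcellb).trans ?_
    rw [Finset.sum_add_distrib, ← Finset.sum_filter, Finset.sum_const, nsmul_eq_mul]
    rw [ENNReal.ofReal_add hD0 (by positivity)]
    refine add_le_add hEsum ?_
    rw [ENNReal.ofReal_mul (p := U) ((hu0 n).trans hun)]
    refine mul_le_mul_left ?_ _
    rw [← ENNReal.ofReal_natCast]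
    exact ENNReal.ofReal_le_ofReal hPU
  · intro p q hpq hqn v hv
    have hwv : ∀ i, p ≤ i → i < q → w i = v := by
      intro i h1 h2
      have hmem : (i : ℝ) / n ∈ Ico ((i : ℝ) / n) (((i : ℝ) + 1) / n) :=
        ⟨le_rfl, div_lt_div_of_pos_right (by linarith) hn'⟩
      rw [← gridFun_of_mem hn w hmem]
      apply hv
      exact ⟨div_le_div_of_nonneg_right (by exact_mod_cast h1) hn'.le,
        div_lt_div_of_pos_right (by exact_mod_cast h2) hn'⟩
    have hpq' : (0 : ℝ) ≤ (q : ℝ) - p := by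
      have : (p : ℝ) < q := by exact_mod_cast hpq
      linarith
    by_cases hex : ∃ i, p ≤ i ∧ i < q ∧ ch i
    · obtain ⟨i, hpi, hiq, hchi⟩ := hex
      -- By the choice of `θ`, an interval of constancy that meets a modified cell consists of that
      -- cell alone.
      have hsingle : ∀ j, p ≤ j → j < q → j = i := by
        intro j h1 h2
        by_contra hne
        have h3 := hgen i (by omega) j (by omega) (Ne.symm hne)
        have h4 := (hwv i hpi hiq).trans (hwv j h1 h2).symm
        simp only [hw, hchi, if_true] at h4
        split_ifs at h4
        · exact h3.1 h4
        · exact h3.2 h4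
      have hpi' := hsingle p le_rfl hpq
      have hqi := hsingle (q - 1) (by omega) (by omega)
      have hq : q = p + 1 := by omega
      subst hpi' hq
      rw [Nat.Ico_succ_singleton, Finset.sum_singleton, ← hwv p le_rfl hpq]
      simp only [hw, hchi, if_true]
      rw [sub_add_cancel_left, abs_neg, abs_of_nonneg (hθi p (by omega)).1]
      push_cast
      rw [add_sub_cancel_left, Real.sqrt_one, one_mul]
      exact (hθi p (by omega)).2.trans (min_le_left _ _)
    · push Not at hex
      have hfl : φ q = φ p := by
        have h1 : ∀ i, p ≤ i → i ≤ q → φ i = φ p := by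
          intro i hpi
          induction i, hpi using Nat.le_induction with
          | base => intro _; rfl
          | succ j hj ih =>
            intro hjq
            rw [← ih (by omega)]
            exact (not_not.1 (hex j hj (by omega))).symm
        exact h1 q hpq.le le_rfl
      obtain ⟨hconst, hen⟩ := hrun p q hpq.le hqn hfl.symm
      have hvi : ∀ i, p ≤ i → i < q → g ((i : ℝ) / n) = v := by
        intro i h1 h2
        rw [← hwv i h1 h2]
        simp only [hw, hex i h1 h2, if_false]
      have hmi : ∀ i ∈ Finset.Ico p q, (m i - v) ^ 2 ≤ n * e i := by
        intro i hi
        rw [Finset.mem_Ico] at hi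
        have h1 := sq_cellMean_sub_le (n := n) hf hL (i := i) (by omega) v
        refine h1.trans (le_of_eq ?_)
        simp only [he, hE]
        congr 2
        refine setLIntegral_congr_fun measurableSet_Ico fun x hx => ?_
        rw [hcell i (by omega) (hex i hi.1 hi.2) x hx, hvi i hi.1 hi.2]
      -- Without modified cells, Cauchy–Schwarz and the cellwise Jensen inequality bound the bias by
      -- the error of `g` on the run.
      rw [← Real.sqrt_mul hpq']
      apply Real.abs_le_sqrt
      refine sq_sum_le_card_mul_sum_sq.trans ?_
      rw [Nat.card_Ico, Nat.cast_sub hpq.le]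
      exact mul_le_mul_of_nonneg_left ((Finset.sum_le_sum hmi).trans hen) hpq'

/-! ### Upper bounds on the good event -/

lemma lqDist_two_sq_triangle {f g h : ℝ → ℝ} (hg : IsCadlag g) (hh : IsCadlag h) :
    lqDist 2 f h ^ 2 ≤ 2 * lqDist 2 f g ^ 2 + 2 * lqDist 2 g h ^ 2 := by
  simp only [lqDist_two_sq]
  have hm : AEMeasurable (fun x => ENNReal.ofReal ((g x - h x) ^ 2))
      (volume.restrict (Ico (0 : ℝ) 1)) :=
    (((hg.aestronglyMeasurable.sub hh.aestronglyMeasurable).pow 2).aemeasurable).ennreal_ofReal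
  rw [← lintegral_const_mul' _ _ (by norm_num), ← lintegral_const_mul' _ _ (by norm_num),
    ← lintegral_add_right' _ (hm.const_mul _)]
  refine lintegral_mono fun x => ?_
  have h2 : (2 : ℝ≥0∞) = ENNReal.ofReal 2 := by simp
  rw [h2, ← ENNReal.ofReal_mul (by norm_num), ← ENNReal.ofReal_mul (by norm_num),
    ← ENNReal.ofReal_add (by positivity) (by positivity)]
  apply ENNReal.ofReal_le_ofReal
  nlinarith [sq_nonneg ((f x - g x) - (g x - h x))]

lemma exists_approx {γ L : ℝ} (hL : 0 < L) {f : ℝ → ℝ} (hf : f ∈ approxClass 2 γ L) {k : ℕ}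
    (hk : 1 ≤ k) : ∃ g, IsStep g ∧ numJumps g ≤ k ∧
      lqDist 2 f g ^ 2 ≤ ENNReal.ofReal (4 * L ^ 2 * (k : ℝ) ^ (-(2 * γ))) := by
  have hk' : (0 : ℝ) < k := by exact_mod_cast hk
  have hkγ : 0 < (k : ℝ) ^ γ := Real.rpow_pos_of_pos hk' _
  have h1 : ENNReal.ofReal ((k : ℝ) ^ γ) * approxErr 2 k f ≤ ENNReal.ofReal L :=
    le_trans (le_iSup₂ (f := fun (k : ℕ) (_ : 1 ≤ k) =>
      ENNReal.ofReal ((k : ℝ) ^ γ) * approxErr 2 k f) k hk) hf.2.1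
  -- The factor 2 makes the inequality strict, so that some `g` realises it even if the infimum is
  -- not attained.
  have h2 : approxErr 2 k f < ENNReal.ofReal (2 * L * (k : ℝ) ^ (-γ)) := by
    by_contra hcon
    push Not at hcon
    have h3 := (mul_le_mul_right hcon (ENNReal.ofReal ((k : ℝ) ^ γ))).trans h1
    rw [← ENNReal.ofReal_mul hkγ.le, ENNReal.ofReal_le_ofReal_iff hL.le, Real.rpow_neg hk'.le] at h3
    have h4 : (k : ℝ) ^ γ * (2 * L * ((k : ℝ) ^ γ)⁻¹) = 2 * L := by field_simp
    linarith
  rw [approxErr, iInf_lt_iff] at h2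
  obtain ⟨g, h2⟩ := h2
  rw [iInf_lt_iff] at h2
  obtain ⟨hg, h2⟩ := h2
  refine ⟨g, hg.1, hg.2, ?_⟩
  refine (pow_le_pow_left' h2.le 2).trans (le_of_eq ?_)
  rw [← ENNReal.ofReal_pow (by positivity), mul_pow, mul_pow, ← Real.rpow_natCast (_ ^ (-γ)),
    ← Real.rpow_mul hk'.le]
  norm_num
  congr 3
  ring

/-- The event on which the reconstruction is controlled. -/
structure IsGoodNoise (c δ A ε : ℝ) (n : ℕ) (𝓘 : Set (ℝ × ℝ))
    (s : (Fin n → ℝ) → (ℝ → ℝ) → ℝ × ℝ → ℝ) (η : ℝ) (z : Fin n → ℝ)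
    (fhat : (Fin n → ℝ) → ℝ → ℝ) : Prop where
  normal : IsNormalSystem c n 𝓘
  penalty : ∀ (y : Fin n → ℝ) (h : ℝ → ℝ), IsGridStep n h →
    ∀ I ∈ 𝓘, |s y h I| ≤ δ * √(Real.log n)
  threshold : η ≤ A * √(Real.log n)
  solution : ∀ y : Fin n → ℝ, IsSegmentation n 𝓘 (s y) η y (fhat y)
  noise : ∀ (y : Fin n → ℝ) (h : ℝ → ℝ), IsGridStep n h → ∀ p q : ℕ, p < q → q ≤ n →
    ((p : ℝ) / n, (q : ℝ) / n) ∈ 𝓘 →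
    |∑ i ∈ Finset.Ico p q, extendZero z i| / √((q : ℝ) - p) ≤
      s y h ((p : ℝ) / n, (q : ℝ) / n) + η - ε * √(Real.log n)

lemma extendZero_obs {n : ℕ} (f : ℝ → ℝ) (z : Fin n → ℝ) {i : ℕ} (hi : i < n) :
    extendZero (obs n f z) i = cellMean n f i + extendZero z i := by
  simp [extendZero, hi, obs, cellMean]

/-- The residual of `h` is noise plus bias; the margin in `IsGoodNoise.noise` is exactly what the
bias may use up. -/
lemma IsGoodNoise.feasible {c δ A ε : ℝ} {n : ℕ} (hn : 0 < n) {𝓘 : Set (ℝ × ℝ)}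
    {s : (Fin n → ℝ) → (ℝ → ℝ) → ℝ × ℝ → ℝ} {η : ℝ} {z : Fin n → ℝ}
    {fhat : (Fin n → ℝ) → ℝ → ℝ} (H : IsGoodNoise c δ A ε n 𝓘 s η z fhat) {f h : ℝ → ℝ}
    (hh : IsGridStep n h)
    (hbias : ∀ p q : ℕ, p < q → q ≤ n → ∀ v : ℝ,
      (∀ x ∈ Ico ((p : ℝ) / n) ((q : ℝ) / n), h x = v) →
        |∑ i ∈ Finset.Ico p q, (cellMean n f i - v)| ≤ √((q : ℝ) - p) * (ε * √(Real.log n))) :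
    multiscaleStat n 𝓘 (s (obs n f z) h) (obs n f z) h ≤ (η : EReal) := by
  rw [H.normal.stat_le_iff hn]
  intro p q hpq hq hI v hv
  have hpq' : (0 : ℝ) < (q : ℝ) - p := by
    have : (p : ℝ) < q := by exact_mod_cast hpq
    linarith
  have hsq := Real.sqrt_pos.2 hpq'
  have h1 := H.noise (obs n f z) h hh p q hpq hq hI
  have h2 := hbias p q hpq hq v hv
  rw [mul_comm, ← div_le_iff₀ hsq] at h2
  have h3 : ∑ i ∈ Finset.Ico p q, (extendZero (obs n f z) i - v) =
      ∑ i ∈ Finset.Ico p q, extendZero z i + ∑ i ∈ Finset.Ico p q, (cellMean n f i - v) := by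
    rw [← Finset.sum_add_distrib]
    refine Finset.sum_congr rfl fun i hi => ?_
    rw [Finset.mem_Ico] at hi
    rw [extendZero_obs f z (by omega)]
    ring
  have h4 : |∑ i ∈ Finset.Ico p q, (extendZero (obs n f z) i - v)| / √((q : ℝ) - p) ≤
      |∑ i ∈ Finset.Ico p q, extendZero z i| / √((q : ℝ) - p) +
        |∑ i ∈ Finset.Ico p q, (cellMean n f i - v)| / √((q : ℝ) - p) := by
    rw [h3, ← add_div]
    exact div_le_div_of_nonneg_right (abs_add_le _ _) hsq.le
  linarith

/-- On the good event, the estimator has few jumps and a small error, uniformly over the class. -/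
lemma exists_upper_constants {γ L c δ A ε C₀ : ℝ} (hL : 0 < L) (hc : 1 < c) (hε : 0 < ε)
    (hC₀ : 0 < C₀) :
    ∃ C₁ : ℕ, 1 ≤ C₁ ∧ ∃ C₂ : ℝ, 0 < C₂ ∧ ∀ (n k : ℕ) (𝓘 : Set (ℝ × ℝ))
      (s : (Fin n → ℝ) → (ℝ → ℝ) → ℝ × ℝ → ℝ) (η : ℝ) (z : Fin n → ℝ)
      (fhat : (Fin n → ℝ) → ℝ → ℝ), 0 < n → 1 ≤ Real.log n → 1 ≤ k →
      (k : ℝ) ^ (-(2 * γ)) * (n / Real.log n) ≤ k →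
      k * (Real.log n / n) ≤ C₀ * (k : ℝ) ^ (-(2 * γ)) →
      IsGoodNoise c δ A ε n 𝓘 s η z fhat → ∀ f ∈ approxClass 2 γ L,
        numJumps (fhat (obs n f z)) ≤ C₁ * k ∧
          lqDist 2 f (fhat (obs n f z)) ^ 2 ≤ ENNReal.ofReal (C₂ * (k : ℝ) ^ (-(2 * γ))) := by
  -- The oracle is used with `t = ε² log n` and squared error `4 L² k^(-2γ)`; by the choice of `k`
  -- its counter is then at most `M k`, and its number of jumps at most `2 M k`.
  set M : ℝ := 1 + 4 * L ^ 2 / ε ^ 2 with hM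
  have hM0 : 0 < M := by positivity
  set C₁ : ℕ := ⌈2 * M⌉₊ with hC₁
  have hC₁M : 2 * M ≤ C₁ := Nat.le_ceil _
  have hC₁pos : 1 ≤ C₁ := Nat.one_le_iff_ne_zero.2 fun h => by
    rw [h] at hC₁M
    simp only [Nat.cast_zero] at hC₁M
    linarith
  have hc0 : 0 < c := by linarith
  refine ⟨C₁, hC₁pos, 2 * (4 * L ^ 2 + M * (2 * L + 1) ^ 2 * C₀) +
    2 * ((2 * C₁ + 1) * (4 * c * (A + δ) ^ 2) * C₀), by positivity, ?_⟩
  intro n k 𝓘 s η z fhat hn hlog hk hk1 hk2 H f hf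
  have hn' : (0 : ℝ) < n := by exact_mod_cast hn
  have hk' : (1 : ℝ) ≤ k := by exact_mod_cast hk
  set l := Real.log n with hl
  set v := (k : ℝ) ^ (-(2 * γ)) with hv
  have hv0 : 0 < v := Real.rpow_pos_of_pos (by linarith) _
  obtain ⟨g, hg, hgk, hgD⟩ := exists_approx hL hf hk
  have hLae := ae_abs_le_of_eLpNorm_top_le hL.le hf.2.2
  have ht : 0 < ε ^ 2 * l := by positivity
  obtain ⟨h, hh, hhK, hhD, hhb⟩ := exists_oracle hn hf.1 hL.le hLae hg hgk (by positivity) hgD ht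
  have hU : (k : ℝ) + n / (ε ^ 2 * l) * (4 * L ^ 2 * v) ≤ M * k := by
    have : n / (ε ^ 2 * l) * (4 * L ^ 2 * v) = 4 * L ^ 2 / ε ^ 2 * (v * (n / l)) := by
      field_simp
    rw [this, hM, add_mul, one_mul]
    gcongr
  have hsqrt : √(ε ^ 2 * l) = ε * √l := by
    rw [Real.sqrt_mul (sq_nonneg _), Real.sqrt_sq hε.le]
  rw [hsqrt] at hhb
  have hfeas := H.feasible hn hh hhb
  have hsol := H.solution (obs n f z)
  have hhK' : numJumps h ≤ C₁ * k := by
    have : (numJumps h : ℝ) ≤ C₁ * k := by nlinarith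
    exact_mod_cast this
  -- The only use of minimality: the estimator has no more jumps than the feasible oracle.
  have hK := (hsol.2.2 h hh hfeas).trans hhK'
  refine ⟨hK, ?_⟩
  set fh := fhat (obs n f z)
  have hR : ∀ g', IsGridStep n g' → ∀ I ∈ 𝓘, η + s (obs n f z) g' I ≤ (A + δ) * √l := by
    intro g' hg' I hI
    have h1 := H.penalty (obs n f z) g' hg' I hI
    have h2 := H.threshold
    have h3 := le_abs_self (s (obs n f z) g' I)
    linarith
  have hdist := H.normal.lqDist_feasible_le hn hc hh hsol.1 hfeas hsol.2.1 (hR _ hh) (hR _ hsol.1)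
  refine (lqDist_two_sq_triangle hh.1.isCadlag hsol.1.1.isCadlag (f := f)).trans ?_
  have h2 : (2 : ℝ≥0∞) = ENNReal.ofReal 2 := by simp
  have e1 : lqDist 2 f h ^ 2 ≤
      ENNReal.ofReal ((4 * L ^ 2 + M * (2 * L + 1) ^ 2 * C₀) * v) := by
    refine hhD.trans (ENNReal.ofReal_le_ofReal ?_)
    have h3 : 1 / (n : ℝ) ≤ l / n := div_le_div_of_nonneg_right hlog hn'.le
    have h4 : ((k : ℝ) + n / (ε ^ 2 * l) * (4 * L ^ 2 * v)) * ((2 * L + 1) ^ 2 * (1 / n)) ≤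
        (M * k) * ((2 * L + 1) ^ 2 * (l / n)) := by gcongr
    have h5 : (M * k) * ((2 * L + 1) ^ 2 * (l / n)) = M * (2 * L + 1) ^ 2 * (k * (l / n)) := by ring
    have h6 : M * (2 * L + 1) ^ 2 * (k * (l / n)) ≤ M * (2 * L + 1) ^ 2 * (C₀ * v) := by gcongr
    linarith
  have e2 : lqDist 2 h fh ^ 2 ≤
      ENNReal.ofReal ((2 * C₁ + 1) * (4 * c * (A + δ) ^ 2) * C₀ * v) := by
    refine hdist.trans (ENNReal.ofReal_le_ofReal ?_)
    have h3 : (numJumps h : ℝ) ≤ C₁ * k := by exact_mod_cast hhK'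
    have h4 : (numJumps fh : ℝ) ≤ C₁ * k := by exact_mod_cast hK
    have h5 : ((A + δ) * √l) ^ 2 = (A + δ) ^ 2 * l := by
      rw [mul_pow, Real.sq_sqrt (by linarith)]
    rw [h5]
    calc ((numJumps h : ℝ) + numJumps fh + 1) * (4 * c * ((A + δ) ^ 2 * l)) * (1 / n)
        ≤ ((2 * C₁ + 1) * k) * (4 * c * ((A + δ) ^ 2 * l)) * (1 / n) := by
          gcongr
          linarith
      _ = (2 * C₁ + 1) * (4 * c * (A + δ) ^ 2) * (k * (l / n)) := by ring
      _ ≤ (2 * C₁ + 1) * (4 * c * (A + δ) ^ 2) * (C₀ * v) := by gcongr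
      _ = _ := by ring
  refine (add_le_add (mul_le_mul_right e1 2) (mul_le_mul_right e2 2)).trans (le_of_eq ?_)
  rw [h2, ← ENNReal.ofReal_mul (by norm_num), ← ENNReal.ofReal_mul (by norm_num),
    ← ENNReal.ofReal_add (by positivity) (by positivity)]
  congr 1
  ring

/-! ### Functions that are badly approximated -/

lemma sum_range_two_mul {M : Type*} [AddCommMonoid M] (a : ℕ → M) (m : ℕ) :
    ∑ i ∈ Finset.range (2 * m), a i = ∑ i ∈ Finset.range m, (a (2 * i) + a (2 * i + 1)) := by
  induction m with
  | zero => simp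
  | succ m ih =>
    rw [Nat.mul_succ, Finset.sum_range_succ, Finset.sum_range_succ, ih, Finset.sum_range_succ,
      add_assoc]

lemma numJumps_const (v : ℝ) : numJumps (fun _ => v) = 0 := by
  have : jumpSet (fun _ : ℝ => v) = ∅ := by
    ext x
    simp [jumpSet, continuousAt_const]
  simp [numJumps, this]

lemma isStep_const (v : ℝ) : IsStep (fun _ => v) := isStep_gridFun one_pos fun _ => v

/-- Pigeonhole: the `4K` cells form `2K` pairs, and at least `K` of them contain no jump of `g` in
their interior. On such a pair `g` is a constant `v`, and `(H - v)² + (H + v)² ≥ 2H²`. -/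
lemma lqDist_alternating_ge {K : ℕ} (hK : 1 ≤ K) (H : ℝ) {g : ℝ → ℝ} (hg : IsStep g)
    (hgK : numJumps g ≤ K) :
    ENNReal.ofReal (H ^ 2 / 2) ≤ lqDist 2 (gridFun (2 * (2 * K)) fun i => (-1) ^ i * H) g ^ 2 := by
  classical
  set w : ℕ → ℝ := fun i => (-1) ^ i * H with hw
  set m := 2 * K with hm
  have hm0 : 0 < m := by omega
  have hn0 : 0 < 2 * m := by omega
  have hK' : (0 : ℝ) < K := by exact_mod_cast hK
  have hm' : (0 : ℝ) < m := by exact_mod_cast hm0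
  have hncast : ((2 * m : ℕ) : ℝ) = 2 * m := by push_cast; ring
  have hn' : (0 : ℝ) < ((2 * m : ℕ) : ℝ) := by exact_mod_cast hn0
  rw [lqDist_two_sq, lintegral_eq_sum_cells hn0, sum_range_two_mul]
  set bad := (Finset.range m).filter fun i : ℕ =>
    ∃ x ∈ Ioo ((i : ℝ) / m) (((i : ℝ) + 1) / m), x ∈ jumpSet g with hbad
  set good := (Finset.range m).filter fun i : ℕ =>
    ¬ ∃ x ∈ Ioo ((i : ℝ) / m) (((i : ℝ) + 1) / m), x ∈ jumpSet g with hgood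
  have hbadcard : bad.card ≤ K := by
    have hsub : bad ⊆ hg.finite_jumpSet.toFinset.image fun x => ⌊(m : ℝ) * x⌋₊ := by
      intro i hi
      obtain ⟨-, x, hx, hxj⟩ := Finset.mem_filter.1 hi
      rw [Finset.mem_image]
      refine ⟨x, (Set.Finite.mem_toFinset _).2 hxj, ?_⟩
      have h1 := (div_lt_iff₀ hm').1 hx.1
      have h2 := (lt_div_iff₀ hm').1 hx.2
      rw [Nat.floor_eq_iff (by nlinarith [Nat.cast_nonneg (α := ℝ) i])]
      constructor <;> linarith
    refine (Finset.card_le_card hsub).trans (Finset.card_image_le.trans ?_)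
    rw [← Set.ncard_eq_toFinset_card _ hg.finite_jumpSet]
    exact hgK
  have hgoodcard : K ≤ good.card := by
    have := Finset.card_filter_add_card_filter_not (s := Finset.range m) fun i : ℕ =>
      ∃ x ∈ Ioo ((i : ℝ) / m) (((i : ℝ) + 1) / m), x ∈ jumpSet g
    rw [Finset.card_range] at this
    change bad.card + good.card = m at this
    omega
  have hpair : ∀ i ∈ good, ENNReal.ofReal (H ^ 2 / m) ≤
      (∫⁻ x in Ico (((2 * i : ℕ) : ℝ) / (2 * m : ℕ)) ((((2 * i : ℕ) : ℝ) + 1) / (2 * m : ℕ)),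
        ENNReal.ofReal ((gridFun (2 * m) w x - g x) ^ 2)) +
      ∫⁻ x in Ico (((2 * i + 1 : ℕ) : ℝ) / (2 * m : ℕ))
        ((((2 * i + 1 : ℕ) : ℝ) + 1) / (2 * m : ℕ)),
        ENNReal.ofReal ((gridFun (2 * m) w x - g x) ^ 2) := by
    intro i hi
    obtain ⟨him, hno⟩ := Finset.mem_filter.1 hi
    rw [Finset.mem_range] at him
    have him' : (i : ℝ) + 1 ≤ m := by exact_mod_cast him
    have hconst := hg.eq_of_no_jump (a := (i : ℝ) / m) (b := ((i : ℝ) + 1) / m) (by positivity)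
      ((div_le_one hm').2 him') fun x hx hxj => hno ⟨x, hx, hxj⟩
    set v := g ((i : ℝ) / m)
    have hcell : ∀ j, 2 * i ≤ j → j ≤ 2 * i + 1 →
        ∫⁻ x in Ico ((j : ℝ) / (2 * m : ℕ)) (((j : ℝ) + 1) / (2 * m : ℕ)),
          ENNReal.ofReal ((gridFun (2 * m) w x - g x) ^ 2) =
        ENNReal.ofReal ((w j - v) ^ 2 * (1 / (2 * m : ℕ))) := by
      intro j h1 h2
      have h1' : 2 * (i : ℝ) ≤ j := by exact_mod_cast h1
      have h2' : (j : ℝ) ≤ 2 * i + 1 := by exact_mod_cast h2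
      rw [setLIntegral_congr_fun (g := fun _ => ENNReal.ofReal ((w j - v) ^ 2)) measurableSet_Ico,
        setLIntegral_const, volume_cell, ENNReal.ofReal_mul (sq_nonneg _)]
      intro x hx
      simp only
      rw [gridFun_of_mem hn0 w hx, hconst x]
      have h3 := (div_le_iff₀ hn').1 hx.1
      have h4 := (lt_div_iff₀ hn').1 hx.2
      rw [hncast] at h3 h4
      constructor
      · rw [div_le_iff₀ hm']; linarith
      · rw [lt_div_iff₀ hm']; linarith
    rw [hcell (2 * i) le_rfl (by omega), hcell (2 * i + 1) (by omega) le_rfl,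
      ← ENNReal.ofReal_add (by positivity) (by positivity)]
    apply ENNReal.ofReal_le_ofReal
    have hw1 : w (2 * i) = H := by simp [hw, pow_mul]
    have hw2 : w (2 * i + 1) = -H := by simp [hw, pow_succ, pow_mul]
    rw [hw1, hw2, hncast, ← add_mul, ← div_eq_mul_one_div, div_le_div_iff₀ hm' (by positivity)]
    have : 0 ≤ m * v ^ 2 := by positivity
    nlinarith
  refine le_trans ?_ (Finset.sum_le_sum_of_subset (Finset.filter_subset _ _ : good ⊆ _))
  refine le_trans ?_ (Finset.sum_le_sum hpair)
  rw [Finset.sum_const, nsmul_eq_mul, ← ENNReal.ofReal_natCast,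
    ← ENNReal.ofReal_mul (by positivity)]
  apply ENNReal.ofReal_le_ofReal
  have hgc : (K : ℝ) ≤ good.card := by exact_mod_cast hgoodcard
  have hm2 : (m : ℝ) = 2 * K := by simp [hm]
  calc H ^ 2 / 2 = K * (H ^ 2 / m) := by rw [hm2]; field_simp
    _ ≤ good.card * (H ^ 2 / m) := by gcongr

/-- With `4K` or more jumps the function is matched exactly; with fewer, the zero function already
has error at most `L (4K)^(-γ)`, which the class allows. -/
lemma alternating_mem_approxClass {γ L : ℝ} (hγ : 0 < γ) (hL : 0 < L) {K : ℕ} (hK : 1 ≤ K) :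
    gridFun (2 * (2 * K)) (fun i => (-1) ^ i * (L * (4 * K : ℝ) ^ (-γ))) ∈ approxClass 2 γ L := by
  have hn0 : 0 < 2 * (2 * K) := by omega
  have hK' : (1 : ℝ) ≤ K := by exact_mod_cast hK
  set H := L * (4 * K : ℝ) ^ (-γ) with hH
  have hH0 : 0 ≤ H := by positivity
  have hHL : H ≤ L := by
    rw [hH]
    refine mul_le_of_le_one_right hL.le ?_
    exact Real.rpow_le_one_of_one_le_of_nonpos (by linarith) (by linarith)
  set f := gridFun (2 * (2 * K)) (fun i => (-1) ^ i * H) with hf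
  have hfs : IsStep f := isStep_gridFun hn0 _
  have hfb : ∀ x, ‖f x‖ ≤ H := by
    intro x
    rw [hf, gridFun, Real.norm_eq_abs, abs_mul, abs_pow, abs_neg, abs_one, one_pow, one_mul,
      abs_of_nonneg hH0]
  refine ⟨hfs.isCadlag, ?_, ?_⟩
  · refine iSup₂_le fun j hj => ?_
    rcases le_or_gt (4 * K) j with h | h
    · have : approxErr 2 j f ≤ 0 := by
        have hj : numJumps f ≤ j := by
          refine (numJumps_gridFun_le hn0 _).trans ((Finset.card_filter_le _ _).trans ?_)
          rw [Nat.card_Ico]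
          omega
        refine (iInf₂_le (f := fun g (_ : g ∈ {g : ℝ → ℝ | IsStep g ∧ numJumps g ≤ j}) =>
          lqDist 2 f g) f ⟨hfs, hj⟩).trans ?_
        simp [lqDist]
      rw [nonpos_iff_eq_zero.1 this, mul_zero]
      exact zero_le
    · have : approxErr 2 j f ≤ ENNReal.ofReal H := by
        refine (iInf₂_le (f := fun g (_ : g ∈ {g : ℝ → ℝ | IsStep g ∧ numJumps g ≤ j}) =>
          lqDist 2 f g) (fun _ => 0) ⟨isStep_const 0, (numJumps_const 0).le.trans
          (Nat.zero_le _)⟩).trans ?_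
        simp only [lqDist, sub_zero]
        refine (eLpNorm_le_of_ae_bound (Eventually.of_forall hfb)).trans ?_
        simp
      refine (mul_le_mul_right this _).trans ?_
      rw [← ENNReal.ofReal_mul (by positivity)]
      apply ENNReal.ofReal_le_ofReal
      have hj' : (j : ℝ) ≤ 4 * K := by exact_mod_cast h.le
      calc (j : ℝ) ^ γ * H ≤ (4 * K : ℝ) ^ γ * H := by gcongr
        _ = L := by
          rw [hH, Real.rpow_neg (by positivity)]
          have : (4 * K : ℝ) ^ γ ≠ 0 := by positivity
          field_simp
  · rw [eLpNorm_exponent_top]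
    exact (eLpNormEssSup_le_of_ae_bound (Eventually.of_forall hfb)).trans
      (ENNReal.ofReal_le_ofReal hHL)

/-! ### The rate -/

lemma exists_rate {γ : ℝ} (hγ : 0 < γ) {n : ℕ} (hlog : 1 ≤ Real.log n) :
    ∃ k : ℕ, 1 ≤ k ∧ (k : ℝ) ^ (-(2 * γ)) * (n / Real.log n) ≤ k ∧
      k * (Real.log n / n) ≤ (2 : ℝ) ^ (1 + 2 * γ) * (k : ℝ) ^ (-(2 * γ)) := by
  have hn0 : (0 : ℝ) < n := by
    rcases Nat.eq_zero_or_pos n with rfl | h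
    · norm_num at hlog
    · exact_mod_cast h
  set l := Real.log n with hl
  have hl0 : 0 < l := by linarith
  have hln : l ≤ n := (Real.log_le_sub_one_of_pos hn0).trans (by linarith)
  set X := (n : ℝ) / l with hX
  have hX1 : 1 ≤ X := (one_le_div hl0).2 hln
  have hX0 : 0 < X := by linarith
  have hd : 0 < 2 * γ + 1 := by linarith
  -- The exact solution of `x^(-2γ) (n / log n) = x`. As `x ≥ 1`, rounding up at most doubles it,
  -- which produces the factor `2^(1+2γ)`.
  set x := X ^ (1 / (2 * γ + 1)) with hx
  have hx1 : 1 ≤ x := Real.one_le_rpow hX1 (by positivity)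
  have hx0 : 0 < x := by linarith
  have hxX : x ^ (2 * γ) * x = X := by
    rw [← Real.rpow_add_one hx0.ne', hx, ← Real.rpow_mul hX0.le, one_div_mul_cancel hd.ne',
      Real.rpow_one]
  have hlX : l / n = X⁻¹ := by rw [hX, inv_div]
  set k := ⌈x⌉₊ with hk
  have hxk : x ≤ k := Nat.le_ceil x
  have hk0 : (0 : ℝ) < k := by linarith
  have hkx : (k : ℝ) ≤ 2 * x := by
    have := Nat.ceil_lt_add_one hx0.le
    linarith
  refine ⟨k, by exact_mod_cast hk0, ?_, ?_⟩
  · calc (k : ℝ) ^ (-(2 * γ)) * X ≤ x ^ (-(2 * γ)) * X := by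
          refine mul_le_mul_of_nonneg_right ?_ hX0.le
          exact Real.rpow_le_rpow_of_nonpos hx0 hxk (by linarith)
      _ = x := by
          rw [Real.rpow_neg hx0.le, ← hxX, inv_mul_cancel_left₀]
          positivity
      _ ≤ k := hxk
  · rw [hlX]
    have h1 : (k : ℝ) * X⁻¹ ≤ 2 * x * X⁻¹ := by gcongr
    have h2 : 2 * x * X⁻¹ = 2 * x ^ (-(2 * γ)) := by
      rw [← hxX, Real.rpow_neg hx0.le]
      have : x ^ (2 * γ) ≠ 0 := by positivity
      field_simp
    have h3 : x ^ (-(2 * γ)) ≤ ((k : ℝ) / 2) ^ (-(2 * γ)) :=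
      Real.rpow_le_rpow_of_nonpos (by positivity) (by linarith) (by linarith)
    have h4 : 2 * ((k : ℝ) / 2) ^ (-(2 * γ)) = (2 : ℝ) ^ (1 + 2 * γ) * (k : ℝ) ^ (-(2 * γ)) := by
      rw [Real.div_rpow hk0.le (by norm_num), Real.rpow_add (by norm_num), Real.rpow_one,
        Real.rpow_neg (by norm_num : (0 : ℝ) ≤ 2)]
      field_simp
    linarith

/-- On the good event, the oracle approximation is not much better than the estimator. -/
lemma exists_comparison_constant {γ L c δ A ε : ℝ} (hγ : 0 < γ) (hL : 0 < L) (hc : 1 < c)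
    (hε : 0 < ε) :
    ∃ C : ℝ, 0 < C ∧ ∀ (n : ℕ) (𝓘 : Set (ℝ × ℝ))
      (s : (Fin n → ℝ) → (ℝ → ℝ) → ℝ × ℝ → ℝ) (η : ℝ) (z : Fin n → ℝ)
      (fhat : (Fin n → ℝ) → ℝ → ℝ) (fapp : (ℝ → ℝ) → ℕ → ℝ → ℝ),
      (∀ f ∈ approxClass 2 γ L, ∀ k : ℕ, IsBestApprox f k (fapp f k)) →
      1 ≤ Real.log n → IsGoodNoise c δ A ε n 𝓘 s η z fhat →
      ENNReal.ofReal C * (⨆ f ∈ approxClass 2 γ L, lqDist 2 f (fhat (obs n f z))) ≤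
        ⨆ f ∈ approxClass 2 γ L, lqDist 2 f (fapp f (numJumps (fhat (obs n f z)))) := by
  obtain ⟨C₁, hC₁, C₂, hC₂, hupper⟩ := exists_upper_constants (γ := γ) (L := L) (c := c) (δ := δ)
    (A := A) (ε := ε) (C₀ := (2 : ℝ) ^ (1 + 2 * γ)) hL hc hε (by positivity)
  have hC₁' : (0 : ℝ) < C₁ := by exact_mod_cast hC₁
  set C₃ : ℝ := L ^ 2 * (4 * C₁ : ℝ) ^ (-(2 * γ)) / 2 with hC₃
  have hC₃0 : 0 < C₃ := by positivity
  refine ⟨√(C₃ / C₂), Real.sqrt_pos.2 (by positivity), ?_⟩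
  intro n 𝓘 s η z fhat fapp hfapp hlog H
  have hn : 0 < n := by
    rcases Nat.eq_zero_or_pos n with rfl | h
    · norm_num at hlog
    · exact h
  obtain ⟨k, hk, hk1, hk2⟩ := exists_rate hγ hlog
  have hk' : (0 : ℝ) < k := by exact_mod_cast hk
  have hup := hupper n k 𝓘 s η z fhat hn hlog hk hk1 hk2 H
  set v := (k : ℝ) ^ (-(2 * γ)) with hv
  have hv0 : 0 < v := Real.rpow_pos_of_pos hk' _
  have hKpos : 1 ≤ C₁ * k := Nat.mul_pos hC₁ hk
  -- A single function, built for the uniform bound `C₁ k` on the number of jumps and hence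
  -- independent of the data, bounds the right-hand supremum from below.
  set f₀ := gridFun (2 * (2 * (C₁ * k)))
    (fun i => (-1) ^ i * (L * (4 * (C₁ * k : ℕ) : ℝ) ^ (-γ))) with hf₀
  have hf₀mem : f₀ ∈ approxClass 2 γ L := alternating_mem_approxClass hγ hL hKpos
  have hlow : ENNReal.ofReal (C₃ * v) ≤
      lqDist 2 f₀ (fapp f₀ (numJumps (fhat (obs n f₀ z)))) ^ 2 := by
    obtain ⟨hb1, hb2, -⟩ := hfapp f₀ hf₀mem (numJumps (fhat (obs n f₀ z)))
    refine le_trans (le_of_eq ?_) (lqDist_alternating_ge hKpos _ hb1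
      (hb2.trans (hup f₀ hf₀mem).1))
    congr 1
    rw [hC₃, hv, mul_pow, ← Real.rpow_natCast (_ ^ (-γ)), ← Real.rpow_mul (by positivity)]
    push_cast
    rw [← mul_assoc (4 : ℝ), Real.mul_rpow (by positivity) hk'.le]
    have : -γ * 2 = -(2 * γ) := by ring
    rw [this]
    ring
  have hleft : ∀ f ∈ approxClass 2 γ L,
      ENNReal.ofReal √(C₃ / C₂) * lqDist 2 f (fhat (obs n f z)) ≤
        lqDist 2 f₀ (fapp f₀ (numJumps (fhat (obs n f₀ z)))) := by
    intro f hf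
    rw [← ENNReal.pow_le_pow_left_iff two_ne_zero]
    refine le_trans ?_ hlow
    rw [mul_pow, ← ENNReal.ofReal_pow (Real.sqrt_nonneg _), Real.sq_sqrt (by positivity)]
    refine (mul_le_mul_right (hup f hf).2 _).trans (le_of_eq ?_)
    rw [← ENNReal.ofReal_mul (by positivity)]
    congr 1
    field_simp
  rw [ENNReal.mul_iSup]
  refine iSup_le fun f => ?_
  rw [ENNReal.mul_iSup]
  refine iSup_le fun hf => (hleft f hf).trans ?_
  exact le_iSup₂ (f := fun f (_ : f ∈ approxClass 2 γ L) =>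
    lqDist 2 f (fapp f (numJumps (fhat (obs n f z))))) f₀ hf₀mem

/-! ### Partial sums of the noise -/

/-- The partial sum of `x` over the indices `p ≤ i < q`. -/
noncomputable def partialSum {n : ℕ} (x : Fin n → ℝ) (p q : ℕ) : ℝ :=
  ∑ i ∈ Finset.Ico p q, extendZero x i

lemma partialSum_eq {n : ℕ} (x : Fin n → ℝ) {p q : ℕ} (hq : q ≤ n) :
    partialSum x p q = ∑ i ∈ Finset.univ.filter (fun i : Fin n => p ≤ i ∧ (i : ℕ) < q), x i := by
  rw [partialSum, Finset.sum_filter]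
  have h : ∀ i : Fin n, (if p ≤ (i : ℕ) ∧ (i : ℕ) < q then x i else 0) =
      (fun j : ℕ => if p ≤ j ∧ j < q then extendZero x j else 0) i := by
    intro i
    simp
  simp_rw [h]
  rw [Fin.sum_univ_eq_sum_range (fun j : ℕ => if p ≤ j ∧ j < q then extendZero x j else 0),
    ← Finset.sum_filter]
  congr 1
  ext i
  simp only [Finset.mem_filter, Finset.mem_range, Finset.mem_Ico]
  omega

lemma card_filter_interval {n p q : ℕ} (hq : q ≤ n) :
    (Finset.univ.filter (fun i : Fin n => p ≤ i ∧ (i : ℕ) < q)).card = q - p := by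
  rw [← Nat.card_Ico]
  refine Finset.card_bij (fun i _ => (i : ℕ)) ?_ ?_ ?_
  · intro i hi
    simpa using hi
  · intro i _ j _ h
    exact Fin.ext h
  · intro j hj
    rw [Finset.mem_Ico] at hj
    exact ⟨⟨j, by omega⟩, by simpa using hj, rfl⟩

lemma continuous_partialSum {n : ℕ} {p q : ℕ} (hq : q ≤ n) :
    Continuous fun x : Fin n → ℝ => partialSum x p q := by
  simp_rw [partialSum_eq _ hq]
  fun_prop

lemma IsNormalSystem.noise_le_iff {c : ℝ} {n : ℕ} (hn : 0 < n) {𝓘 : Set (ℝ × ℝ)}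
    (h𝓘 : IsNormalSystem c n 𝓘) {s : ℝ × ℝ → ℝ} {x : Fin n → ℝ} {b : ℝ} :
    multiscaleStat n 𝓘 s x (fun _ => 0) ≤ (b : EReal) ↔
      ∀ p q : ℕ, p < q → q ≤ n → ((p : ℝ) / n, (q : ℝ) / n) ∈ 𝓘 →
        |partialSum x p q| / √((q : ℝ) - p) ≤ s ((p : ℝ) / n, (q : ℝ) / n) + b := by
  have hn' : (0 : ℝ) < n := by exact_mod_cast hn
  rw [h𝓘.stat_le_iff hn]
  constructor
  · intro h p q hpq hq hI
    have := h p q hpq hq hI 0 fun _ _ => rfl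
    simp only [sub_zero] at this
    rw [partialSum]
    linarith
  · intro h p q hpq hq hI v hv
    have hv0 : 0 = v := hv ((p : ℝ) / n)
      ⟨le_rfl, div_lt_div_of_pos_right (by exact_mod_cast hpq) hn'⟩
    subst hv0
    simp only [sub_zero]
    have := h p q hpq hq hI
    rw [partialSum] at this
    linarith

lemma IsNormalSystem.measurableSet_noise_le {c : ℝ} {n : ℕ} (hn : 0 < n) {𝓘 : Set (ℝ × ℝ)}
    (h𝓘 : IsNormalSystem c n 𝓘) (s : ℝ × ℝ → ℝ) (b : ℝ) :
    MeasurableSet {x : Fin n → ℝ | multiscaleStat n 𝓘 s x (fun _ => 0) ≤ (b : EReal)} := by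
  have : {x : Fin n → ℝ | multiscaleStat n 𝓘 s x (fun _ => 0) ≤ (b : EReal)} =
      ⋂ (p : ℕ) (q : ℕ) (_ : p < q) (_ : q ≤ n) (_ : ((p : ℝ) / n, (q : ℝ) / n) ∈ 𝓘),
        {x | |partialSum x p q| / √((q : ℝ) - p) ≤ s ((p : ℝ) / n, (q : ℝ) / n) + b} := by
    ext x
    simp only [Set.mem_ofPred_eq, h𝓘.noise_le_iff hn, mem_iInter]
  rw [this]
  refine MeasurableSet.iInter fun p => MeasurableSet.iInter fun q => MeasurableSet.iInter fun _ =>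
    MeasurableSet.iInter fun hq => MeasurableSet.iInter fun _ => ?_
  have := (continuous_partialSum (p := p) hq).measurable
  exact measurableSet_le (by fun_prop) measurable_const

/-! ### Sub-Gaussian tails -/

lemma hasSubgaussianMGF_mono {Ω : Type*} [MeasurableSpace Ω] {μ : Measure Ω} {X : Ω → ℝ}
    {c c' : ℝ≥0} (h : HasSubgaussianMGF X c μ) (hc : c ≤ c') : HasSubgaussianMGF X c' μ where
  integrable_exp_mul := h.integrable_exp_mul
  mgf_le t := (h.mgf_le t).trans (Real.exp_le_exp.2 (by gcongr))

section tails

variable {Ω : Type*} [MeasurableSpace Ω] {μ : Measure Ω} {σ : ℝ≥0}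
  {ξ : (n : ℕ) → Fin n → Ω → ℝ}

/-- The event that some normalised partial sum of the noise is at least `b`. -/
def largeNoise (ξ : (n : ℕ) → Fin n → Ω → ℝ) (n : ℕ) (b : ℝ) : Set Ω :=
  ⋃ (p : Fin n) (q : Fin n),
    {ω | (p : ℕ) ≤ q ∧ b * √(((q : ℕ) + 1 : ℕ) - (p : ℕ) : ℝ) ≤
      |partialSum (fun i => ξ n i ω) p (q + 1)|}

lemma measurableSet_largeNoise (hm : ∀ n i, Measurable (ξ n i)) (n : ℕ) (b : ℝ) :
    MeasurableSet (largeNoise ξ n b) := by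
  refine MeasurableSet.iUnion fun p => MeasurableSet.iUnion fun q => ?_
  have h1 : Measurable fun ω => partialSum (fun i => ξ n i ω) p (q + 1) :=
    (continuous_partialSum q.2).measurable.comp (measurable_pi_lambda _ fun i => hm n i)
  have h2 : Measurable fun ω => |partialSum (fun i => ξ n i ω) p (q + 1)| := by fun_prop
  exact (MeasurableSet.const _).inter (measurableSet_le measurable_const h2)

lemma abs_partialSum_div_sqrt_le {Ω : Type*} {ξ : (n : ℕ) → Fin n → Ω → ℝ} {n : ℕ} {b : ℝ} {ω : Ω}
    (h : ω ∉ largeNoise ξ n b) {p q : ℕ}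
    (hpq : p < q) (hq : q ≤ n) :
    |partialSum (fun i => ξ n i ω) p q| / √((q : ℝ) - p) ≤ b := by
  simp only [largeNoise, mem_iUnion, not_exists, Set.mem_ofPred_eq, not_and, not_le] at h
  have h1 := h ⟨p, by omega⟩ ⟨q - 1, by omega⟩ (by simp only; omega)
  simp only at h1
  rw [Nat.sub_add_cancel (by omega : 1 ≤ q)] at h1
  have hpq' : (0 : ℝ) < (q : ℝ) - p := by
    have : (p : ℝ) < q := by exact_mod_cast hpq
    linarith
  rw [div_le_iff₀ (Real.sqrt_pos.2 hpq')]
  exact h1.le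

/-- Normalised partial sums keep the sub-Gaussian scale, so the two-sided Chernoff bound is the same
for all of the at most `n²` intervals. The larger scale `σ'` is left free so that the exponent can
be prescribed. -/
lemma measure_largeNoise_le [IsFiniteMeasure μ] (hξ : IsSubGaussianNoise μ σ ξ) {σ' : ℝ≥0} (hσ : σ ≤ σ') (n : ℕ)
    {b : ℝ} (hb : 0 ≤ b) :
    μ.real (largeNoise ξ n b) ≤ (n : ℝ) ^ 2 * (2 * Real.exp (-b ^ 2 / (2 * (σ' : ℝ) ^ 2))) := by
  have hone : ∀ p q : Fin n, μ.real {ω | (p : ℕ) ≤ q ∧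
      b * √(((q : ℕ) + 1 : ℕ) - (p : ℕ) : ℝ) ≤ |partialSum (fun i => ξ n i ω) p (q + 1)|} ≤
      2 * Real.exp (-b ^ 2 / (2 * (σ' : ℝ) ^ 2)) := by
    intro p q
    by_cases hpq : (p : ℕ) ≤ q
    · set d : ℝ := ((q : ℕ) + 1 : ℕ) - (p : ℕ) with hd
      have hd0 : 0 < d := by
        have : ((p : ℕ) : ℝ) < ((q : ℕ) + 1 : ℕ) := by exact_mod_cast Nat.lt_succ_of_le hpq
        rw [hd]; linarith
      set S := Finset.univ.filter (fun i : Fin n => (p : ℕ) ≤ i ∧ (i : ℕ) < q + 1)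
      have hS : (S.card : ℝ) = d := by
        rw [card_filter_interval q.2, Nat.cast_sub (by omega)]
      have hsg : ∀ i ∈ S, HasSubgaussianMGF (ξ n i) (σ' ^ 2) μ := fun i _ =>
        hasSubgaussianMGF_mono (hξ.subGaussian n i) (pow_le_pow_left' hσ 2)
      have hsum := HasSubgaussianMGF.sum_of_iIndepFun (hξ.indep n) hsg
      have hnn : 0 ≤ b * √d := by positivity
      have hexp : -(b * √d) ^ 2 / (2 * ((∑ _i ∈ S, σ' ^ 2 : ℝ≥0) : ℝ)) =
          -b ^ 2 / (2 * (σ' : ℝ) ^ 2) := by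
        rw [Finset.sum_const, nsmul_eq_mul, mul_pow, Real.sq_sqrt hd0.le]
        push_cast
        rw [hS]
        rcases eq_or_ne (σ' : ℝ) 0 with h0 | h0
        · simp [h0]
        · field_simp
      have h1 := hsum.measure_ge_le hnn
      have h2 := hsum.neg.measure_ge_le hnn
      rw [hexp] at h1 h2
      calc μ.real {ω | (p : ℕ) ≤ q ∧ b * √d ≤ |partialSum (fun i => ξ n i ω) p (q + 1)|}
          ≤ μ.real ({ω | b * √d ≤ ∑ i ∈ S, ξ n i ω} ∪
              {ω | b * √d ≤ (-fun ω => ∑ i ∈ S, ξ n i ω) ω}) := by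
            refine measureReal_mono ?_
            rintro ω ⟨-, hω⟩
            rw [partialSum_eq _ q.2, le_abs] at hω
            exact hω
        _ ≤ _ := measureReal_union_le _ _
        _ ≤ _ := by linarith
    · have : {ω | (p : ℕ) ≤ q ∧
          b * √(((q : ℕ) + 1 : ℕ) - (p : ℕ) : ℝ) ≤ |partialSum (fun i => ξ n i ω) p (q + 1)|} = ∅ := by
        ext ω
        simp [hpq]
      rw [this, measureReal_empty]
      positivity
  refine (measureReal_iUnion_fintype_le _).trans ?_
  refine (Finset.sum_le_sum fun p _ => (measureReal_iUnion_fintype_le _).trans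
    (Finset.sum_le_sum fun q _ => hone p q)).trans (le_of_eq ?_)
  simp only [Finset.sum_const, Finset.card_univ, Fintype.card_fin, nsmul_eq_mul]
  ring

lemma measure_largeNoise_log_le [IsFiniteMeasure μ] (hξ : IsSubGaussianNoise μ σ ξ) {r t : ℝ} (hr : 0 < r)
    (ht : σ * √(2 * r + 4) < t) {n : ℕ} (hn : 0 < n) :
    μ.real (largeNoise ξ n (t * √(Real.log n))) ≤ 2 * (n : ℝ) ^ (-r) := by
  have hn' : (0 : ℝ) < n := by exact_mod_cast hn
  have hlog : 0 ≤ Real.log n := Real.log_natCast_nonneg n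
  have hs : 0 < √(2 * r + 4) := Real.sqrt_pos.2 (by linarith)
  have ht0 : 0 < t := lt_of_le_of_lt (by positivity) ht
  -- With this scale the exponent is `-(r + 2) log n`, and `n²` of it pays for the union bound. It
  -- is positive even when `σ = 0`.
  set σ' : ℝ≥0 := ⟨t / √(2 * r + 4), by positivity⟩ with hσ'
  have hσ'v : (σ' : ℝ) = t / √(2 * r + 4) := rfl
  have hσ : σ ≤ σ' := by
    rw [← NNReal.coe_le_coe, hσ'v, le_div_iff₀ hs]
    exact ht.le
  refine (measure_largeNoise_le hξ hσ n (by positivity)).trans (le_of_eq ?_)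
  have hexp : -(t * √(Real.log n)) ^ 2 / (2 * (σ' : ℝ) ^ 2) = Real.log n * (-(r + 2)) := by
    rw [hσ'v, div_pow, mul_pow, Real.sq_sqrt hlog, Real.sq_sqrt (by linarith)]
    field_simp
    ring
  rw [hexp, ← Real.rpow_def_of_pos hn', neg_add, Real.rpow_add hn', Real.rpow_neg hn'.le 2]
  norm_cast
  field_simp

end tails

/-! ### Gaussian noise -/

/-- On `(ρ, ρ + 1]` the density is at least its value at the right end. -/
lemma gaussianReal_Ioi_ge {v : ℝ≥0} (hv : v ≠ 0) {ρ : ℝ} (hρ : 0 ≤ ρ) :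
    ENNReal.ofReal ((√(2 * Real.pi * v))⁻¹ * Real.exp (-(ρ + 1) ^ 2 / (2 * v))) ≤
      gaussianReal 0 v (Ioi ρ) := by
  rw [gaussianReal_apply 0 hv]
  calc ENNReal.ofReal ((√(2 * Real.pi * v))⁻¹ * Real.exp (-(ρ + 1) ^ 2 / (2 * v)))
      = ∫⁻ _x in Ioc ρ (ρ + 1),
          ENNReal.ofReal ((√(2 * Real.pi * v))⁻¹ * Real.exp (-(ρ + 1) ^ 2 / (2 * v))) := by
        rw [setLIntegral_const, Real.volume_Ioc]
        simp
    _ ≤ ∫⁻ x in Ioc ρ (ρ + 1), gaussianPDF 0 v x := by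
        refine setLIntegral_mono' measurableSet_Ioc fun x hx => ?_
        rw [gaussianPDF, gaussianPDFReal]
        refine ENNReal.ofReal_le_ofReal ?_
        rw [sub_zero]
        gcongr
        · linarith [hx.1]
        · exact hx.2
    _ ≤ ∫⁻ x in Ioi ρ, gaussianPDF 0 v x := lintegral_mono_set fun x hx => hx.1

/-- The law with variance `V` is the image of the one with variance `v` under multiplication by
`±√(V / v)`, and this factor has modulus at least `√d`. -/
lemma gaussianReal_tail_mono {v V : ℝ≥0} (hv : v ≠ 0) {d ρ : ℝ} (hd : 0 < d) (hρ : 0 ≤ ρ)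
    (hV : v * d ≤ V) :
    gaussianReal 0 v (Ioi ρ) ≤ gaussianReal 0 V {x | ρ * √d < x} ∧
      gaussianReal 0 v (Ioi ρ) ≤ gaussianReal 0 V {x | ρ * √d < -x} := by
  have hv' : (0 : ℝ) < v := by exact_mod_cast pos_iff_ne_zero.2 hv
  have hmap : ∀ e : ℝ, e ^ 2 = V / v → (gaussianReal 0 v).map (e * ·) = gaussianReal 0 V := by
    intro e he
    rw [gaussianReal_map_const_mul, mul_zero]
    congr 1
    apply NNReal.eq
    show e ^ 2 * (v : ℝ) = V
    rw [he, div_mul_cancel₀ _ hv'.ne']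
  have hle : √d ≤ √(V / v) := Real.sqrt_le_sqrt (by rw [le_div_iff₀ hv']; linarith)
  have hsd : 0 < √d := Real.sqrt_pos.2 hd
  have hsq : √((V : ℝ) / v) ^ 2 = V / v := Real.sq_sqrt (by positivity)
  constructor
  · rw [← hmap _ hsq, Measure.map_apply (by fun_prop) (measurableSet_lt (by fun_prop) (by fun_prop))]
    refine measure_mono fun x hx => ?_
    rw [mem_Ioi] at hx
    show ρ * √d < √((V : ℝ) / v) * x
    nlinarith
  · rw [← hmap (-√((V : ℝ) / v)) (by rw [neg_sq, hsq]),
      Measure.map_apply (by fun_prop) (measurableSet_lt (by fun_prop) (by fun_prop))]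
    refine measure_mono fun x hx => ?_
    rw [mem_Ioi] at hx
    show ρ * √d < -(-√((V : ℝ) / v) * x)
    nlinarith

lemma partialSum_rotation {n : ℕ} (x x' : Fin n → ℝ) (a b : ℝ) (p q : ℕ) :
    partialSum (a • x + b • x') p q = a * partialSum x p q + b * partialSum x' p q := by
  simp only [partialSum, Finset.mul_sum, ← Finset.sum_add_distrib]
  refine Finset.sum_congr rfl fun i _ => ?_
  by_cases h : i < n <;> simp [extendZero, h]

/-- Anti-concentration of the multiscale statistic of Gaussian noise: its law is not changed if the
noise is rotated towards an independent copy, which is large with non-negligible probability. -/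
lemma IsNormalSystem.gaussian_margin {c : ℝ} {n : ℕ} (hn : 0 < n) {𝓘 : Set (ℝ × ℝ)}
    (h𝓘 : IsNormalSystem c n 𝓘) (s : ℝ × ℝ → ℝ) (π : Measure (Fin n → ℝ)) [IsGaussian π]
    (hπ : ∀ ℓ : StrongDual ℝ (Fin n → ℝ), π[ℓ] = 0) {ρ M u x₀ S : ℝ} {Q : ℝ≥0∞}
    (hQ : ∀ p q : ℕ, p < q → q ≤ n →
      Q ≤ π {x | ρ * √((q : ℝ) - p) < partialSum x p q} ∧
      Q ≤ π {x | ρ * √((q : ℝ) - p) < -partialSum x p q})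
    (hM0 : 0 ≤ M) (hM : ∀ I ∈ 𝓘, s I + x₀ ≤ M) (hS0 : 0 < S) (hS1 : S ≤ 1)
    (hu : u ≤ S * ρ - S ^ 2 * M) :
    π {x | multiscaleStat n 𝓘 s x (fun _ => 0) ≤ (x₀ : EReal)}ᶜ * Q ≤
      π {x | multiscaleStat n 𝓘 s x (fun _ => 0) ≤ ((x₀ + u : ℝ) : EReal)}ᶜ := by
  set T₀ := {x : Fin n → ℝ | multiscaleStat n 𝓘 s x (fun _ => 0) ≤ (x₀ : EReal)}ᶜ with hT₀
  set T₁ := {x : Fin n → ℝ | multiscaleStat n 𝓘 s x (fun _ => 0) ≤ ((x₀ + u : ℝ) : EReal)}ᶜ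
    with hT₁
  have hm₀ : MeasurableSet T₀ := (h𝓘.measurableSet_noise_le hn s x₀).compl
  have hm₁ : MeasurableSet T₁ := (h𝓘.measurableSet_noise_le hn s (x₀ + u)).compl
  set θ := Real.arcsin S with hθ
  have hsin : Real.sin θ = S := Real.sin_arcsin (by linarith) hS1
  have hcos0 : 0 ≤ Real.cos θ := Real.cos_arcsin_nonneg S
  set C := Real.cos θ with hC
  have hC1 : C ≤ 1 := Real.cos_le_one θ
  -- Shrinking by the cosine costs only second order in `S`, while the independent copy contributes
  -- `S ρ`; hence the condition on `u`.
  have hCS : 1 - C ≤ S ^ 2 := by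
    have := Real.sin_sq_add_cos_sq θ
    rw [hsin, ← hC] at this
    nlinarith
  have hrot := IsGaussian.map_rotation_eq_self_of_forall_strongDual_eq_zero (μ := π) hπ θ
  -- The first coordinate of the rotated pair again has law `π`.
  have hinv : π T₁ = (π.prod π) {z | C • z.1 + S • z.2 ∈ T₁} := by
    have h1 : π T₁ = (π.prod π) (T₁ ×ˢ univ) := by
      rw [Measure.prod_prod, measure_univ, mul_one]
    rw [h1, ← hrot, Measure.map_apply (by fun_prop) (hm₁.prod MeasurableSet.univ)]
    rw [hrot]
    congr 1
    ext z
    simp [ContinuousLinearMap.rotation_apply, hsin, ← hC]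
  have hmeas : MeasurableSet {z : (Fin n → ℝ) × (Fin n → ℝ) | C • z.1 + S • z.2 ∈ T₁} :=
    hm₁.preimage (by fun_prop)
  rw [hinv, Measure.prod_apply hmeas, mul_comm, ← setLIntegral_const]
  refine le_trans ?_ (setLIntegral_le_lintegral T₀ _)
  refine setLIntegral_mono' hm₀ fun x hx => ?_
  have hx' : ¬ (multiscaleStat n 𝓘 s x (fun _ => 0) ≤ (x₀ : EReal)) := hx
  rw [h𝓘.noise_le_iff hn] at hx'
  push Not at hx'
  obtain ⟨p, q, hpq, hq, hI, hlt⟩ := hx'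
  have hpq' : (0 : ℝ) < (q : ℝ) - p := by
    have : (p : ℝ) < q := by exact_mod_cast hpq
    linarith
  have hsq := Real.sqrt_pos.2 hpq'
  have hMI := hM _ hI
  set d := √((q : ℝ) - p) with hd
  set m := s ((p : ℝ) / n, (q : ℝ) / n) + x₀ with hm
  set a := |partialSum x p q| / d with ha
  have ha0 : 0 ≤ a := by positivity
  have had : |partialSum x p q| = a * d := by rw [ha, div_mul_cancel₀ _ hsq.ne']
  have hgain : m + u ≤ C * a + S * ρ := by
    have h1 : m - (1 - C) * M ≤ C * a := by
      rcases le_or_gt 0 m with h | h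
      · nlinarith [mul_nonneg (sub_nonneg.2 hC1) (sub_nonneg.2 hMI),
          mul_nonneg hcos0 (sub_nonneg.2 hlt.le)]
      · nlinarith [mul_nonneg (sub_nonneg.2 hC1) hM0, mul_nonneg hcos0 ha0]
    nlinarith [mul_nonneg (sub_nonneg.2 hCS) hM0]
  have hsuff : ∀ x' : Fin n → ℝ, (m + u) * d < |C * partialSum x p q + S * partialSum x' p q| →
      x' ∈ Prod.mk x ⁻¹' {z : (Fin n → ℝ) × (Fin n → ℝ) | C • z.1 + S • z.2 ∈ T₁} := by
    intro x' h
    show ¬ (multiscaleStat n 𝓘 s (C • x + S • x') (fun _ => 0) ≤ ((x₀ + u : ℝ) : EReal))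
    rw [h𝓘.noise_le_iff hn]
    push Not
    refine ⟨p, q, hpq, hq, hI, ?_⟩
    rw [partialSum_rotation, lt_div_iff₀ hsq, ← add_assoc]
    exact h
  -- The copy has to push the violating sum away from zero, so its tail is needed on the side given
  -- by the sign of that sum.
  rcases le_or_gt 0 (partialSum x p q) with h | h
  · refine (hQ p q hpq hq).1.trans (measure_mono fun x' hx' => hsuff x' ?_)
    have hx'' : ρ * d < partialSum x' p q := hx'
    rw [abs_of_nonneg h] at had
    refine lt_of_lt_of_le ?_ (le_abs_self _)
    rw [had]
    calc (m + u) * d ≤ (C * a + S * ρ) * d := mul_le_mul_of_nonneg_right hgain hsq.le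
      _ = C * (a * d) + S * (ρ * d) := by ring
      _ < _ := by gcongr
  · refine (hQ p q hpq hq).2.trans (measure_mono fun x' hx' => hsuff x' ?_)
    have hx'' : ρ * d < -partialSum x' p q := hx'
    rw [abs_of_neg h] at had
    refine lt_of_lt_of_le ?_ (neg_le_abs _)
    calc (m + u) * d ≤ (C * a + S * ρ) * d := mul_le_mul_of_nonneg_right hgain hsq.le
      _ = C * (a * d) + S * (ρ * d) := by ring
      _ < C * (a * d) + S * (-partialSum x' p q) := by gcongr
      _ = _ := by rw [← had]; ring

section gaussianNoise

variable {Ω : Type*} [MeasurableSpace Ω] {μ : Measure Ω}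
  {ξ : (n : ℕ) → Fin n → Ω → ℝ}

lemma hasGaussianLaw_noise (hi : ∀ n, iIndepFun (ξ n) μ) {n : ℕ}
    (hG : ∀ i, ∃ v : ℝ≥0, μ.map (ξ n i) = gaussianReal 0 v) :
    HasGaussianLaw (fun ω i => ξ n i ω) μ := by
  refine iIndepFun.hasGaussianLaw (fun i => ⟨?_⟩) (hi n)
  obtain ⟨v, hv⟩ := hG i
  rw [hv]
  infer_instance

lemma integral_noise_eq_zero (hm : ∀ n i, Measurable (ξ n i)) {n : ℕ}
    (hG : ∀ i, ∃ v : ℝ≥0, μ.map (ξ n i) = gaussianReal 0 v) (i : Fin n) :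
    Integrable (ξ n i) μ ∧ ∫ ω, ξ n i ω ∂μ = 0 := by
  obtain ⟨v, hv⟩ := hG i
  have hlaw : HasGaussianLaw (ξ n i) μ := ⟨by rw [hv]; infer_instance⟩
  refine ⟨hlaw.integrable, ?_⟩
  rw [← integral_id_gaussianReal (μ := 0) (v := v), ← hv,
    integral_map (hm n i).aemeasurable (by fun_prop)]

lemma integral_dual_noise (hm : ∀ n i, Measurable (ξ n i)) {n : ℕ}
    (hG : ∀ i, ∃ v : ℝ≥0, μ.map (ξ n i) = gaussianReal 0 v)
    (ℓ : StrongDual ℝ (Fin n → ℝ)) : (μ.map fun ω i => ξ n i ω)[ℓ] = 0 := by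
  rw [integral_map (measurable_pi_lambda _ fun i => hm n i).aemeasurable (by fun_prop)]
  have h : ∀ ω, ℓ (fun i => ξ n i ω) = ∑ i, ξ n i ω * ℓ (Pi.single i 1) := by
    intro ω
    conv_lhs => rw [pi_eq_sum_univ' (fun i => ξ n i ω)]
    rw [map_sum]
    refine Finset.sum_congr rfl fun i _ => ?_
    rw [map_smul, smul_eq_mul]
  simp_rw [h]
  rw [integral_finsetSum _ fun i _ => (integral_noise_eq_zero hm hG i).1.mul_const _]
  refine Finset.sum_eq_zero fun i _ => ?_
  rw [integral_mul_const, (integral_noise_eq_zero hm hG i).2, zero_mul]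

lemma map_partialSum_noise [IsProbabilityMeasure μ] (hm : ∀ n i, Measurable (ξ n i)) (hi : ∀ n, iIndepFun (ξ n) μ) {n : ℕ}
    {v₀ : ℝ≥0} (hG : ∀ i, ∃ v : ℝ≥0, v₀ ≤ v ∧ μ.map (ξ n i) = gaussianReal 0 v) {p q : ℕ}
    (hpq : p ≤ q) (hq : q ≤ n) :
    ∃ V : ℝ≥0, (v₀ : ℝ) * ((q : ℝ) - p) ≤ V ∧
      (μ.map fun ω i => ξ n i ω).map (fun x => partialSum x p q) = gaussianReal 0 V := by
  have hG' : ∀ i, ∃ v : ℝ≥0, μ.map (ξ n i) = gaussianReal 0 v := fun i =>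
    (hG i).imp fun v hv => hv.2
  set S := Finset.univ.filter (fun i : Fin n => p ≤ i ∧ (i : ℕ) < q) with hS
  have hlaw : HasGaussianLaw (fun ω => ∑ i ∈ S, ξ n i ω) μ := by
    have h1 := (hasGaussianLaw_noise hi hG').map_fun
      (∑ i ∈ S, ContinuousLinearMap.proj (R := ℝ) (φ := fun _ : Fin n => ℝ) i)
    simpa using h1
  have hmap := hlaw.map_eq_gaussianReal
  have hmean : ∫ ω, ∑ i ∈ S, ξ n i ω ∂μ = 0 := by
    rw [integral_finsetSum _ fun i _ => (integral_noise_eq_zero hm hG' i).1]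
    exact Finset.sum_eq_zero fun i _ => (integral_noise_eq_zero hm hG' i).2
  refine ⟨Var[fun ω => ∑ i ∈ S, ξ n i ω; μ].toNNReal, ?_, ?_⟩
  rotate_left
  · rw [Measure.map_map (continuous_partialSum hq).measurable
      (measurable_pi_lambda _ fun i => hm n i)]
    have : (fun x => partialSum x p q) ∘ (fun ω i => ξ n i ω) = fun ω => ∑ i ∈ S, ξ n i ω := by
      ext ω
      exact partialSum_eq _ hq
    rw [this, hmap, hmean]
  · rw [Real.coe_toNNReal _ (variance_nonneg _ _)]
    have hvar : Var[fun ω => ∑ i ∈ S, ξ n i ω; μ] = ∑ i ∈ S, Var[ξ n i; μ] := by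
      have h2 := IndepFun.variance_sum (μ := μ) (X := ξ n) (s := S)
        (fun i _ => by
          obtain ⟨v, hv⟩ := hG' i
          have hl : HasGaussianLaw (ξ n i) μ := ⟨by rw [hv]; infer_instance⟩
          exact hl.memLp_two)
        (fun i _ j _ hij => (hi n).indepFun hij)
      rw [← h2]
      congr 1
      ext ω
      simp
    rw [hvar]
    have hcard : ((q : ℝ) - p) = S.card := by
      rw [hS, card_filter_interval hq, Nat.cast_sub hpq]
    rw [hcard, mul_comm, ← nsmul_eq_mul]
    refine Finset.card_nsmul_le_sum _ _ _ fun i _ => ?_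
    obtain ⟨v, hv, hvm⟩ := hG i
    have h3 : Var[ξ n i; μ] = v := by
      rw [← variance_id_gaussianReal (μ := 0) (v := v), ← hvm,
        variance_map (by fun_prop) (hm n i).aemeasurable]
      rfl
    rw [h3]
    exact_mod_cast hv

end gaussianNoise

/-! ### Thresholds and the probability of the good event -/

section assembly

variable {Ω : Type*} [MeasurableSpace Ω] {μ : Measure Ω} {σ : ℝ≥0}
  {ξ : (n : ℕ) → Fin n → Ω → ℝ} {c δ : ℝ} {𝓘 : ℕ → Set (ℝ × ℝ)} {s₀ : ℕ → ℝ × ℝ → ℝ}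

lemma measurableSet_noiseStat_le (hm : ∀ n i, Measurable (ξ n i)) {n : ℕ} (hn : 0 < n)
    (h𝓘 : IsNormalSystem c n (𝓘 n)) (b : ℝ) :
    MeasurableSet {ω | noiseStat 𝓘 s₀ ξ n ω ≤ (b : EReal)} :=
  (h𝓘.measurableSet_noise_le hn (s₀ n) b).preimage (measurable_pi_lambda _ fun i => hm n i)

lemma log_pos_of_two_le {n : ℕ} (hn : 2 ≤ n) : 0 < Real.log n :=
  Real.log_pos (by exact_mod_cast hn)

/-- Outside the event of large noise, the statistic of pure noise is small. -/
lemma noiseStat_le_of_notMem {Ω : Type*} {ξ : (n : ℕ) → Fin n → Ω → ℝ} {n : ℕ} (hn : 0 < n) (h𝓘 : IsNormalSystem c n (𝓘 n)) {b B : ℝ}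
    (hs : ∀ I ∈ 𝓘 n, b ≤ s₀ n I + B) {ω : Ω} (hω : ω ∉ largeNoise ξ n b) :
    noiseStat 𝓘 s₀ ξ n ω ≤ (B : EReal) := by
  rw [noiseStat, h𝓘.noise_le_iff hn]
  intro p q hpq hq hI
  exact (abs_partialSum_div_sqrt_le hω hpq hq).trans (hs _ hI)

lemma tendsto_rpow_neg_nat {r : ℝ} (hr : 0 < r) :
    Tendsto (fun n : ℕ => (n : ℝ) ^ (-r)) atTop (𝓝 0) :=
  (tendsto_rpow_neg_atTop hr).comp tendsto_natCast_atTop_atTop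

lemma one_sub_le_measure_noiseStat [IsProbabilityMeasure μ] (hξ : IsSubGaussianNoise μ σ ξ)
    {r t : ℝ} (hr : 0 < r) (ht : σ * √(2 * r + 4) < t) {n : ℕ} (hn : 0 < n)
    (h𝓘 : IsNormalSystem c n (𝓘 n)) (hs : ∀ I ∈ 𝓘 n, |s₀ n I| ≤ δ * √(Real.log n)) :
    1 - 2 * (n : ℝ) ^ (-r) ≤
      μ.real {ω | noiseStat 𝓘 s₀ ξ n ω ≤ (((t + δ) * √(Real.log n) : ℝ) : EReal)} := by
  have h1 := measure_largeNoise_log_le hξ hr ht hn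
  have h2 := probReal_compl_eq_one_sub (μ := μ)
    (measurableSet_largeNoise hξ.measurable n (t * √(Real.log n)))
  have h3 : μ.real (largeNoise ξ n (t * √(Real.log n)))ᶜ ≤
      μ.real {ω | noiseStat 𝓘 s₀ ξ n ω ≤ (((t + δ) * √(Real.log n) : ℝ) : EReal)} := by
    refine measureReal_mono fun ω hω => noiseStat_le_of_notMem hn h𝓘 (fun I hI => ?_) hω
    have := (abs_le.1 (hs I hI)).1
    linarith
  linarith

/-- The refined threshold is of order at most `√(log n)`. -/
lemma upperQuantile_le [IsProbabilityMeasure μ] (hξ : IsSubGaussianNoise μ σ ξ) (hδ : 0 < δ)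
    (h𝓘 : ∀ n, 2 ≤ n → IsNormalSystem c n (𝓘 n))
    (hs : ∀ n, 2 ≤ n → ∀ I ∈ 𝓘 n, |s₀ n I| ≤ δ * √(Real.log n)) {β : ℕ → ℝ} {q : ℝ}
    (hq : 0 < q) (hβ : (fun n : ℕ => (n : ℝ) ^ (-q)) =O[atTop] β)
    (hβ0 : ∀ n, 2 ≤ n → 0 < β n) :
    ∃ A : ℝ, 0 < A ∧ ∀ᶠ n in atTop,
      ({x : ℝ | 1 - β n ≤ μ.real {ω | noiseStat 𝓘 s₀ ξ n ω ≤ (x : EReal)}}).Nonempty ∧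
        upperQuantile μ (noiseStat 𝓘 s₀ ξ n) (β n) ≤ A * √(Real.log n) := by
  -- The exponent is `q + 1` rather than `q`, so that the tail `2 n^(-(q+1))` falls below `β n`
  -- whatever the constant in `hβ`.
  set t : ℝ := σ * √(2 * (q + 1) + 4) + 1 with ht
  have ht0 : 0 < t := by positivity
  refine ⟨t + δ, by positivity, ?_⟩
  obtain ⟨B, hB0, hB⟩ := hβ.exists_pos
  have hlim := (tendsto_rpow_neg_nat one_pos).const_mul (2 * B)
  rw [mul_zero] at hlim
  filter_upwards [hB.bound, eventually_ge_atTop 2, hlim.eventually (gt_mem_nhds one_pos)]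
    with n hn hn2 hn1
  have hn0 : (0 : ℝ) < n := by exact_mod_cast (by omega : 0 < n)
  rw [Real.norm_of_nonneg (by positivity), Real.norm_of_nonneg (hβ0 n hn2).le] at hn
  have h1 := one_sub_le_measure_noiseStat hξ (by linarith : 0 < q + 1)
    (show σ * √(2 * (q + 1) + 4) < t by rw [ht]; linarith) (by omega : 0 < n)
    (h𝓘 n hn2) (hs n hn2)
  have h2 : 2 * (n : ℝ) ^ (-(q + 1)) ≤ β n := by
    rw [neg_add, Real.rpow_add hn0]
    have h3 : 2 * ((n : ℝ) ^ (-q) * (n : ℝ) ^ (-1 : ℝ)) ≤ 2 * (B * β n * (n : ℝ) ^ (-1 : ℝ)) := by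
      gcongr
    have h4 : 2 * B * (n : ℝ) ^ (-1 : ℝ) * β n ≤ 1 * β n :=
      mul_le_mul_of_nonneg_right hn1.le (hβ0 n hn2).le
    linarith
  have hmem : (t + δ) * √(Real.log n) ∈
      {x : ℝ | 1 - β n ≤ μ.real {ω | noiseStat 𝓘 s₀ ξ n ω ≤ (x : EReal)}} :=
    le_trans (by linarith) h1
  refine ⟨⟨_, hmem⟩, ?_⟩
  rw [upperQuantile]
  by_cases hbdd : BddBelow {x : ℝ | 1 - β n ≤ μ.real {ω | noiseStat 𝓘 s₀ ξ n ω ≤ (x : EReal)}}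
  · exact csInf_le hbdd hmem
  -- Here the infimum is 0 by convention, which also satisfies the bound.
  · rw [Real.sInf_of_not_bddBelow hbdd]
    positivity

/-- The strict inequality `hb` avoids the question whether the infimum is attained; `hne` excludes
the conventional value `sInf ∅ = 0`. -/
lemma measure_noiseStat_compl_le_of_upperQuantile_lt [IsProbabilityMeasure μ]
    (hm : ∀ n i, Measurable (ξ n i)) {n : ℕ} (hn : 0 < n) (h𝓘 : IsNormalSystem c n (𝓘 n))
    {β b : ℝ}
    (hne : ({x : ℝ | 1 - β ≤ μ.real {ω | noiseStat 𝓘 s₀ ξ n ω ≤ (x : EReal)}}).Nonempty)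
    (hb : upperQuantile μ (noiseStat 𝓘 s₀ ξ n) β < b) :
    μ.real {ω | noiseStat 𝓘 s₀ ξ n ω ≤ (b : EReal)}ᶜ ≤ β := by
  obtain ⟨x, hx, hxb⟩ := exists_lt_of_csInf_lt hne hb
  rw [probReal_compl_eq_one_sub (measurableSet_noiseStat_le hm hn h𝓘 b)]
  have h1 : μ.real {ω | noiseStat 𝓘 s₀ ξ n ω ≤ (x : EReal)} ≤
      μ.real {ω | noiseStat 𝓘 s₀ ξ n ω ≤ (b : EReal)} :=
    measureReal_mono fun ω hω => le_trans hω (EReal.coe_le_coe_iff.2 hxb.le)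
  have h2 : 1 - β ≤ μ.real {ω | noiseStat 𝓘 s₀ ξ n ω ≤ (x : EReal)} := hx
  linarith

/-- For Gaussian noise, the refined threshold exceeds the statistic of pure noise by a margin. -/
lemma hasMargin_of_isGaussianNoise [IsProbabilityMeasure μ] (hξ : IsSubGaussianNoise μ σ ξ)
    (hG : IsGaussianNoise μ ξ) (hδ : 0 < δ)
    (h𝓘 : ∀ n, 2 ≤ n → IsNormalSystem c n (𝓘 n))
    (hs : ∀ n, 2 ≤ n → ∀ I ∈ 𝓘 n, |s₀ n I| ≤ δ * √(Real.log n)) {β η : ℕ → ℝ} {r A : ℝ}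
    (hr : 0 < r) (hA : 0 < A) (hβ : β =O[atTop] fun n : ℕ => (n : ℝ) ^ (-r))
    (hη : ∀ᶠ n in atTop, η n = upperQuantile μ (noiseStat 𝓘 s₀ ξ n) (β n) ∧
      ({x : ℝ | 1 - β n ≤ μ.real {ω | noiseStat 𝓘 s₀ ξ n ω ≤ (x : EReal)}}).Nonempty ∧
      η n ≤ A * √(Real.log n)) :
    HasMargin μ 𝓘 s₀ ξ η := by
  obtain ⟨v₀, hv₀, hG⟩ := hG
  have hv₀' : (0 : ℝ) < v₀ := by exact_mod_cast hv₀
  -- With this `R`, a Gaussian variable of variance `v₀` exceeds `R √(log n)` with probability at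
  -- least a multiple of `n^(-r/2)`, half the exponent available in `β n`.
  set R : ℝ := √(v₀ * r / 2) with hR
  have hR0 : 0 < R := Real.sqrt_pos.2 (by positivity)
  have hR2 : R ^ 2 = v₀ * r / 2 := Real.sq_sqrt (by positivity)
  set M : ℝ := A + δ with hM
  have hM0 : 0 < M := by positivity
  -- The loss `S² M` is then at most half of the gain `S R`; what remains is at least `S R / 2 = 2
  -- ε`.
  set S : ℝ := min 1 (R / (2 * M)) with hS
  have hS0 : 0 < S := lt_min one_pos (by positivity)
  have hS1 : S ≤ 1 := min_le_left _ _
  have hSM : S * M ≤ R / 2 := by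
    have : S ≤ R / (2 * M) := min_le_right _ _
    rw [le_div_iff₀ (by positivity)] at this
    linarith
  set ε : ℝ := S * R / 4 with hε
  have hε0 : 0 < ε := by positivity
  set κ : ℝ := (√(2 * Real.pi * v₀))⁻¹ * Real.exp (-1 / v₀) with hκ
  have hκ0 : 0 < κ := by positivity
  obtain ⟨B, hB0, hB⟩ := hβ.exists_pos
  refine ⟨ε, hε0, ?_⟩
  have hbound : ∀ᶠ n : ℕ in atTop,
      μ.real {ω | noiseStat 𝓘 s₀ ξ n ω ≤ ((η n - ε * √(Real.log n) : ℝ) : EReal)}ᶜ ≤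
        B / κ * (n : ℝ) ^ (-(r / 2)) := by
    filter_upwards [hη, hB.bound, eventually_ge_atTop 2] with n hn hnB hn2
    obtain ⟨hn1, hne, hnA⟩ := hn
    have hn0 : 0 < n := by omega
    have hn' : (0 : ℝ) < n := by exact_mod_cast hn0
    have hlog := log_pos_of_two_le hn2
    have hsq : 0 < √(Real.log n) := Real.sqrt_pos.2 hlog
    set l := √(Real.log n) with hl
    have hl2 : l ^ 2 = Real.log n := Real.sq_sqrt hlog.le
    have hX : Measurable (fun ω i => ξ n i ω) := measurable_pi_lambda _ fun i => hξ.measurable n i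
    set π := μ.map (fun ω i => ξ n i ω) with hπ
    have hG' : ∀ i, ∃ v : ℝ≥0, μ.map (ξ n i) = gaussianReal 0 v := fun i =>
      (hG n i).imp fun v hv => hv.2
    have : IsGaussian π := (hasGaussianLaw_noise hξ.indep hG').isGaussian_map
    set Q : ℝ≥0∞ := gaussianReal 0 v₀ (Ioi (R * l)) with hQ
    have hQ1 : ∀ p q : ℕ, p < q → q ≤ n →
        Q ≤ π {x | R * l * √((q : ℝ) - p) < partialSum x p q} ∧
        Q ≤ π {x | R * l * √((q : ℝ) - p) < -partialSum x p q} := by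
      intro p q hpq hq
      obtain ⟨V, hV, hVm⟩ := map_partialSum_noise hξ.measurable hξ.indep (hG n) hpq.le hq
      have hpq' : (0 : ℝ) < (q : ℝ) - p := by
        have : (p : ℝ) < q := by exact_mod_cast hpq
        linarith
      have h := gaussianReal_tail_mono hv₀.ne' hpq' (by positivity : 0 ≤ R * l) hV
      rw [← hVm, Measure.map_apply (continuous_partialSum hq).measurable
        (measurableSet_lt (by fun_prop) (by fun_prop)),
        Measure.map_apply (continuous_partialSum hq).measurable
        (measurableSet_lt (by fun_prop) (by fun_prop))] at h
      exact h
    -- The rotation leads from `ε √(log n)` below the quantile to `ε √(log n)` above it, where the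
    -- exceedance probability is at most `β n`. Dividing by `Q` leaves `O(n^(-r/2))`.
    have hgm := (h𝓘 n hn2).gaussian_margin hn0 (s₀ n) π
      (integral_dual_noise hξ.measurable hG') (ρ := R * l) (M := M * l) (u := 2 * ε * l)
      (x₀ := η n - ε * l) (S := S) (Q := Q) hQ1 (by positivity)
      (fun I hI => by
        have h1 := (abs_le.1 (hs n hn2 I hI)).2
        have h2 : 0 ≤ ε * l := by positivity
        rw [hM]
        linarith)
      hS0 hS1 (by
        have h1 : S * (S * M) * l ≤ S * (R / 2) * l := by gcongr
        rw [hε]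
        linarith)
    have hmap : ∀ b : ℝ, π {x | multiscaleStat n (𝓘 n) (s₀ n) x (fun _ => 0) ≤ (b : EReal)}ᶜ =
        μ {ω | noiseStat 𝓘 s₀ ξ n ω ≤ (b : EReal)}ᶜ := fun b => by
      rw [hπ, Measure.map_apply hX ((h𝓘 n hn2).measurableSet_noise_le hn0 (s₀ n) b).compl]
      rfl
    rw [hmap, hmap] at hgm
    have hreal : μ.real {ω | noiseStat 𝓘 s₀ ξ n ω ≤ ((η n - ε * l : ℝ) : EReal)}ᶜ * Q.toReal ≤
        μ.real {ω | noiseStat 𝓘 s₀ ξ n ω ≤ ((η n - ε * l + 2 * ε * l : ℝ) : EReal)}ᶜ := by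
      rw [Measure.real, ← ENNReal.toReal_mul]
      exact ENNReal.toReal_mono (measure_ne_top _ _) hgm
    have hβn := measure_noiseStat_compl_le_of_upperQuantile_lt hξ.measurable hn0 (h𝓘 n hn2) hne
      (b := η n - ε * l + 2 * ε * l) (by
        rw [← hn1]
        have : 0 < ε * l := by positivity
        linarith)
    have hQr : κ * (n : ℝ) ^ (-(r / 2)) ≤ Q.toReal := by
      have h1 := ENNReal.toReal_mono (measure_ne_top _ _)
        (gaussianReal_Ioi_ge hv₀.ne' (by positivity : 0 ≤ R * l))
      rw [ENNReal.toReal_ofReal (by positivity)] at h1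
      refine le_trans ?_ h1
      rw [hκ, mul_assoc, Real.rpow_def_of_pos hn', ← Real.exp_add]
      gcongr
      have h2 : (R * l + 1) ^ 2 ≤ 2 * (R ^ 2 * Real.log n) + 2 := by
        rw [← hl2]
        nlinarith [sq_nonneg (R * l - 1)]
      rw [hR2] at h2
      rw [le_div_iff₀ (by positivity), add_mul, neg_div, neg_mul, div_mul_eq_mul_div,
        one_mul, mul_div_assoc, div_self hv₀'.ne']
      linarith
    rw [Real.norm_of_nonneg (by positivity : 0 ≤ (n : ℝ) ^ (-r))] at hnB
    have hnB' := (le_abs_self (β n)).trans hnB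
    set P := μ.real {ω | noiseStat 𝓘 s₀ ξ n ω ≤ ((η n - ε * l : ℝ) : EReal)}ᶜ with hP
    have hP0 : 0 ≤ P := measureReal_nonneg
    have h5 : P * (κ * (n : ℝ) ^ (-(r / 2))) ≤ B * (n : ℝ) ^ (-r) :=
      (mul_le_mul_of_nonneg_left hQr hP0).trans (hreal.trans (hβn.trans hnB'))
    have h6 : (n : ℝ) ^ (-r) = (n : ℝ) ^ (-(r / 2)) * (n : ℝ) ^ (-(r / 2)) := by
      rw [← Real.rpow_add hn']
      congr 1
      ring
    have h7 : 0 < (n : ℝ) ^ (-(r / 2)) := Real.rpow_pos_of_pos hn' _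
    rw [h6] at h5
    have h8 : P * κ ≤ B * (n : ℝ) ^ (-(r / 2)) :=
      le_of_mul_le_mul_right (by linarith) h7
    rw [div_mul_eq_mul_div, le_div_iff₀ hκ0]
    exact h8
  have hlim : Tendsto (fun n : ℕ => B / κ * (n : ℝ) ^ (-(r / 2))) atTop (𝓝 0) := by
    simpa using (tendsto_rpow_neg_nat (half_pos hr)).const_mul (B / κ)
  have hcompl := squeeze_zero' (Eventually.of_forall fun _ => measureReal_nonneg) hbound hlim
  have hfin : Tendsto (fun n => ENNReal.ofReal (1 -
      μ.real {ω | noiseStat 𝓘 s₀ ξ n ω ≤ ((η n - ε * √(Real.log n) : ℝ) : EReal)}ᶜ)) atTop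
      (𝓝 1) := by
    have := (hcompl.const_sub 1)
    rw [sub_zero] at this
    simpa using ENNReal.tendsto_ofReal this
  refine hfin.congr' ?_
  filter_upwards [eventually_ge_atTop 2] with n hn2
  rw [probReal_compl_eq_one_sub (measurableSet_noiseStat_le hξ.measurable (by omega) (h𝓘 n hn2) _),
    sub_sub_cancel, ofReal_measureReal]

/-- The penalised noise stays below the threshold, with a margin of order `√(log n)`, on events
whose probabilities tend to one. -/
lemma exists_noise_events [IsProbabilityMeasure μ] (hξ : IsSubGaussianNoise μ σ ξ)
    {s : (n : ℕ) → Ω → (Fin n → ℝ) → (ℝ → ℝ) → ℝ × ℝ → ℝ} {η : ℕ → ℝ}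
    {fhat : (n : ℕ) → Ω → (Fin n → ℝ) → ℝ → ℝ}
    (hfhat : IsMultiscaleEstimator μ c δ 𝓘 s η fhat)
    (hη : IsUniversalThreshold σ δ η ∨
      ∃ s₀ : ℕ → ℝ × ℝ → ℝ, IsRefinedThreshold μ 𝓘 s s₀ ξ η ∧
        (IsGaussianNoise μ ξ ∨ HasMargin μ 𝓘 s₀ ξ η)) :
    ∃ A ε : ℝ, 0 < ε ∧ ∃ F : ℕ → Set Ω, Tendsto (fun n => μ (F n)) atTop (𝓝 1) ∧
      ∀ᶠ n in atTop, MeasurableSet (F n) ∧ η n ≤ A * √(Real.log n) ∧ ∀ ω ∈ F n,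
        (∀ (y : Fin n → ℝ) (h : ℝ → ℝ), IsGridStep n h →
          ∀ I ∈ 𝓘 n, |s n ω y h I| ≤ δ * √(Real.log n)) →
        ∀ (y : Fin n → ℝ) (h : ℝ → ℝ), IsGridStep n h → ∀ p q : ℕ, p < q → q ≤ n →
          ((p : ℝ) / n, (q : ℝ) / n) ∈ 𝓘 n →
          |∑ i ∈ Finset.Ico p q, extendZero (fun i => ξ n i ω) i| / √((q : ℝ) - p) ≤
            s n ω y h ((p : ℝ) / n, (q : ℝ) / n) + η n - ε * √(Real.log n) := by
  rcases hη with ⟨r, hr, a, ha, hηa⟩ | ⟨s₀, ⟨hs₀, β, hβ01, ⟨r, hr, hβr⟩, ⟨q, hq, hβq⟩, hηβ⟩, hG⟩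
  -- The midpoint leaves room on both sides: for the noise bound below and for the margin `ε = a - δ
  -- - t` above.
  · set t : ℝ := (a - δ + σ * √(2 * r + 4)) / 2 with ht
    have ht1 : σ * √(2 * r + 4) < t := by rw [ht]; linarith
    refine ⟨a, a - δ - t, by rw [ht]; linarith,
      fun n => (largeNoise ξ n (t * √(Real.log n)))ᶜ, ?_, ?_⟩
    · have hlim : Tendsto (fun n : ℕ => 2 * (n : ℝ) ^ (-r)) atTop (𝓝 0) := by
        simpa using (tendsto_rpow_neg_nat hr).const_mul 2
      have h0 := squeeze_zero' (Eventually.of_forall fun _ => measureReal_nonneg)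
        ((eventually_gt_atTop 0).mono fun n hn => measure_largeNoise_log_le hξ hr ht1 hn) hlim
      have h1 := h0.const_sub 1
      rw [sub_zero] at h1
      have h2 := ENNReal.tendsto_ofReal h1
      rw [ENNReal.ofReal_one] at h2
      refine h2.congr fun n => ?_
      rw [← probReal_compl_eq_one_sub (measurableSet_largeNoise hξ.measurable n _),
        ofReal_measureReal]
    · filter_upwards [eventually_ge_atTop 2] with n hn2
      refine ⟨(measurableSet_largeNoise hξ.measurable n _).compl, (hηa n hn2).le, ?_⟩
      intro ω hω hpen y h hh p q' hpq hq' hI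
      have h1 := abs_partialSum_div_sqrt_le hω hpq hq'
      rw [partialSum] at h1
      have h2 := (abs_le.1 (hpen y h hh _ hI)).1
      rw [hηa n hn2]
      linarith
  · have hs : ∀ n, 2 ≤ n → ∀ I ∈ 𝓘 n, |s₀ n I| ≤ δ * √(Real.log n) := by
      intro n hn I hI
      -- As the penalties are deterministic, their bound can be read off at one sample point and one
      -- candidate.
      obtain ⟨ω, hω⟩ := hfhat.penalty.exists
      have := hω n hn (fun _ => 0) _ (isGridStep_gridFun (by omega : 0 < n) fun _ => 0) I hI
      rwa [hs₀] at this
    obtain ⟨A, hA, hAq⟩ := upperQuantile_le hξ hfhat.pos hfhat.normal hs hq hβq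
      fun n hn => (hβ01 n hn).1
    have hmargin : HasMargin μ 𝓘 s₀ ξ η := by
      rcases hG with hG | hG
      · refine hasMargin_of_isGaussianNoise hξ hG hfhat.pos hfhat.normal hs hr hA hβr ?_
        filter_upwards [hAq, eventually_ge_atTop 2] with n hn hn2
        rw [hηβ n hn2]
        exact ⟨rfl, hn⟩
      · exact hG
    obtain ⟨ε, hε, hF⟩ := hmargin
    refine ⟨A, ε, hε, _, hF, ?_⟩
    filter_upwards [hAq, eventually_ge_atTop 2] with n hn hn2
    refine ⟨measurableSet_noiseStat_le hξ.measurable (by omega) (hfhat.normal n hn2) _, ?_, ?_⟩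
    · rw [hηβ n hn2]
      exact hn.2
    · intro ω hω _ y h hh p q' hpq hq' hI
      have h1 := ((hfhat.normal n hn2).noise_le_iff (by omega)).1 hω p q' hpq hq' hI
      rw [partialSum] at h1
      rw [hs₀]
      linarith

end assembly

end ChangePoint

theorem proposition2 {Ω : Type*} [MeasurableSpace Ω] (μ : Measure Ω) [IsProbabilityMeasure μ]
    (σ : ℝ≥0) (ξ : (n : ℕ) → Fin n → Ω → ℝ) (hξ : ChangePoint.IsSubGaussianNoise μ σ ξ)
    (γ L : ℝ) (hγ : 0 < γ) (hL : 0 < L)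
    (c δ : ℝ) (𝓘 : ℕ → Set (ℝ × ℝ))
    (s : (n : ℕ) → Ω → (Fin n → ℝ) → (ℝ → ℝ) → ℝ × ℝ → ℝ) (η : ℕ → ℝ)
    (fhat : (n : ℕ) → Ω → (Fin n → ℝ) → ℝ → ℝ)
    (hfhat : ChangePoint.IsMultiscaleEstimator μ c δ 𝓘 s η fhat)
    (hη : ChangePoint.IsUniversalThreshold σ δ η ∨
      ∃ s₀ : ℕ → ℝ × ℝ → ℝ, ChangePoint.IsRefinedThreshold μ 𝓘 s s₀ ξ η ∧
        (ChangePoint.IsGaussianNoise μ ξ ∨ ChangePoint.HasMargin μ 𝓘 s₀ ξ η))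
    (fapp : (ℝ → ℝ) → ℕ → ℝ → ℝ)
    (hfapp : ∀ f ∈ ChangePoint.approxClass 2 γ L, ∀ k : ℕ,
      ChangePoint.IsBestApprox f k (fapp f k)) :
    ∃ C : ℝ, 0 < C ∧ ∃ E : ℕ → Set Ω,
      (∀ n, MeasurableSet (E n)) ∧ Tendsto (fun n => μ (E n)) atTop (𝓝 1) ∧
      ∀ n, ∀ ω ∈ E n,
        ENNReal.ofReal C *
            (⨆ f ∈ ChangePoint.approxClass 2 γ L,
              ChangePoint.lqDist 2 f
                (fhat n ω (ChangePoint.obs n f (fun i => ξ n i ω)))) ≤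
          ⨆ f ∈ ChangePoint.approxClass 2 γ L,
            ChangePoint.lqDist 2 f
              (fapp f (ChangePoint.numJumps
                (fhat n ω (ChangePoint.obs n f (fun i => ξ n i ω))))) := by
  classical
  obtain ⟨A, ε, hε, F, hF, hev⟩ := ChangePoint.exists_noise_events hξ hfhat hη
  obtain ⟨C, hC, hmain⟩ := ChangePoint.exists_comparison_constant (δ := δ) (A := A) hγ hL
    hfhat.one_lt hε
  -- A measurable set of full measure on which the almost sure assumptions hold simultaneously for
  -- all `n ≥ 2`, all data and all grid candidates.
  obtain ⟨G, hG, hGm, hGp⟩ := (hfhat.penalty.and hfhat.solution).exists_measurable_mem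
  have hlog : ∀ᶠ n : ℕ in atTop, 1 ≤ Real.log n :=
    (Real.tendsto_log_atTop.comp tendsto_natCast_atTop_atTop).eventually_ge_atTop 1
  obtain ⟨N, hN⟩ := eventually_atTop.1 (hev.and (hlog.and (eventually_ge_atTop 2)))
  -- For the finitely many `n < N` the event is empty, which does not affect the limit.
  refine ⟨C, hC, fun n => if N ≤ n then F n ∩ G else ∅, fun n => ?_, ?_, fun n ω hω => ?_⟩
  · dsimp only
    split_ifs with h
    · exact (hN n h).1.1.inter hGm
    · exact MeasurableSet.empty
  · refine hF.congr' ?_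
    filter_upwards [eventually_ge_atTop N] with n hn
    rw [if_pos hn]
    exact (measure_inter_conull (mem_ae_iff.1 hG)).symm
  · dsimp only at hω
    split_ifs at hω with h
    · obtain ⟨⟨-, hηA, hnoise⟩, hlogn, hn2⟩ := hN n h
      obtain ⟨hpen, hsol⟩ := hGp ω hω.2
      exact hmain n (𝓘 n) (s n ω) (η n) (fun i => ξ n i ω) (fhat n ω) fapp hfapp hlogn
        ⟨hfhat.normal n hn2, hpen n hn2, hηA, hsol n hn2,
          hnoise ω hω.1 (hpen n hn2)⟩
    · exact absurd hω (notMem_empty ω)
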